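/- **Theorem (sealability in $\mathrm{Rel}$ is undecidable).** Let $n\ge 1$ and let $\mathbb P=\{1,\dots,n\}$ be a set of processes, each with countably many integer variables of its own. Programs are given by $$P ::= \epsilon \mid x:=e \mid \mathrm{snd}_{i\to j}(e) \mid \mathrm{rcv}_{j\leftarrow i}(x) \mid [\phi] \mid \wr \mid P\bullet P \mid P+P \mid P^{*},$$ with $e$ an arithmetic expression over the variables of the process that executes the statement, and $\phi$ a propositional formula over atoms $e=e'$, $e<e'$. *Runs.* A run $r$ consists of an infinite sequence $r_i$ of local states for each process $i$ (values of the variables of $i$ and the history of its sends and receives) and an injective function $\delta_r$ from the receive events to the send events of $r$, matching each receipt of $v$ by $j$ from $i$ with a sending of $v$ by $i$ to $j$, such that Lamport's causality relation is irreflexive. $\mathrm{Rel}$ is the set of runs in which no unmatched send is succeeded by infinitely many matched sends on the same channel. A cut is a family $c\in(\mathbb N\cup\{\infty\})^{\mathbb P}$; it contains the first $c_i$ events of each process $i$, and is finite if all $c_i$ are. *Semantics.* $r[c,d]\Vdash P$ ("$P$ occurs over $r[c,d]$", $c\le d$) is defined by recursion: $\epsilon$ occurs iff $c=d$; an assignment,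 send or receive of process $i$ occurs iff $d=c[i\mapsto c_i+1]$ and, if $c_i<\infty$, $r_i(c_i+1)$ arises from $r_i(c_i)$ by the statement; $[\phi]$ occurs iff $c=d$ and $\phi$ holds at $c$, for some choice of the values of the variables of processes with $c_i=\infty$; $\wr$ occurs iff $c=d$ and $\delta_r$ matches no event in the cut with an event outside it; $P\bullet Q$ occurs iff $r[c,c']\Vdash P$ and $r[c',d]\Vdash Q$ for some $c\le c'\le d$; $P+Q$ occurs iff $P$ or $Q$ does; $P^*$ occurs iff $d$ is the supremum of a finite or infinite sequence $c=c^{(0)}\le c^{(1)}\le\cdots$ with $r[c^{(k)},c^{(k+1)}]\Vdash P$ for all $k$. *Deadlock-freedom.* A partial execution of $P$ is an execution in which each process may stop for good at any point of its share of $P$; a guard is then only subject to the values of the processes that have reached it (with no condition if none has), and a $\wr$ is checked only once all processes have reached it. $P$ is deadlock-free if every finite partial execution of $P$ in a run of $\mathrm{Rel}$ that starts at a finite cut $c$ at which $\wr$ holds, and ends at a cut $d$ in which every received message was also sent, can be continued: some $r'\in\mathrm{Rel}$ that agrees with the given run up to $d$ and some $d'\ge d$ satisfy $r'[c,d']\Vdash{\wr}\bullet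 P$, and every message received in the cut $(r',d')$ was sent in it. *Seals.* $S$ seals $P$ (in $\mathrm{Rel}$) if, for all $r\in\mathrm{Rel}$ and $c\le d$, $r[c,d]\Vdash{\wr}\bullet P\bullet S$ implies $r[c,d]\Vdash P\bullet{\wr}\bullet S$. It is a proper seal of $P$ if moreover, whenever $r\in\mathrm{Rel}$, $r[c,d]\Vdash{\wr}\bullet P$, $r[d,d']\Vdash{\wr}\bullet S$ and $d$ is finite, then $d'$ is finite. $P$ is sealable in $\mathrm{Rel}$ if it has a proper seal $S$ that does not contain $\wr$ and such that $S$ and $P\bullet S$ are deadlock-free. Then, for every $n\ge1$, sealability in $\mathrm{Rel}$ is undecidable: there is no computable function which, given (the Gödel number of) a deadlock-free program $P$, decides whether $P$ is sealable in $\mathrm{Rel}$. -/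

import Mathlib

namespace Sealing

/-! ### Programs -/

/-- Arithmetic expressions over the variables of one process; values are integers and the
variables of each process are numbered by `ℕ`. -/
inductive Expr : Type
  | const (z : ℤ)
  | var (x : ℕ)
  | add (a b : Expr)
  | sub (a b : Expr)
  | mul (a b : Expr)

/-- The value of an expression under a valuation of the variables. -/
def Expr.eval (σ : ℕ → ℤ) : Expr → ℤ
  | .const z => z
  | .var x => σ x
  | .add a b => a.eval σ + b.eval σ
  | .sub a b => a.eval σ - b.eval σ
  | .mul a b => a.eval σ * b.eval σ

/-- Propositional formulas over the atoms `a = b` and `a < b`, where `a` is an expression of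
process `i` and `b` is an expression of process `j`. -/
inductive Formula (n : ℕ) : Type
  | eq (i : Fin n) (a : Expr) (j : Fin n) (b : Expr)
  | lt (i : Fin n) (a : Expr) (j : Fin n) (b : Expr)
  | not (φ : Formula n)
  | and (φ ψ : Formula n)
  | or (φ ψ : Formula n)

/-- Truth of a formula, given a valuation of the variables of every process. -/
def Formula.eval {n : ℕ} (σ : Fin n → ℕ → ℤ) : Formula n → Prop
  | .eq i a j b => a.eval (σ i) = b.eval (σ j)
  | .lt i a j b => a.eval (σ i) < b.eval (σ j)
  | .not φ => ¬ φ.eval σ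
  | .and φ ψ => φ.eval σ ∧ ψ.eval σ
  | .or φ ψ => φ.eval σ ∨ ψ.eval σ

/-- The language of programs for the `n` processes `Fin n`. -/
inductive Prog (n : ℕ) : Type
  /-- the empty program -/
  | skip
  /-- process `i` assigns the value of `e` to its variable `x` -/
  | assign (i : Fin n) (x : ℕ) (e : Expr)
  /-- process `i` sends the value of `e` to process `j` -/
  | send (i j : Fin n) (e : Expr)
  /-- process `i` receives a message from process `j` into its variable `x` -/
  | recv (i j : Fin n) (x : ℕ)
  /-- the guard `[φ]` -/
  | guard (φ : Formula n)
  /-- the silent cut: all channels are empty -/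
  | silent
  /-- layered composition -/
  | layer (P Q : Prog n)
  /-- nondeterministic choice -/
  | choice (P Q : Prog n)
  /-- finitely or infinitely many repetitions -/
  | rpt (P : Prog n)

/-! ### Runs -/

/-- A send or receive record in the history of a process `i`. The own index `i` is left implicit:
`sent j v` stands for `(i → j, v)` and `received j v` for `(i ← j, v)`. -/
inductive Record (n : ℕ) : Type
  | sent (j : Fin n) (v : ℤ)
  | received (j : Fin n) (v : ℤ)

/-- A local state: values of the variables and the communication history. -/
structure LocalState (n : ℕ) : Type where
  vars : ℕ → ℤ
  hist : List (Record n)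

/-- The event `(i, k)` is the transition of process `i` from its `k`-th to its `k+1`-st local
state. -/
abbrev Event (n : ℕ) : Type := Fin n × ℕ

/-- The event `e` appends the record `ρ` to the history of its process. -/
def Appends {n : ℕ} (st : Fin n → ℕ → LocalState n) (e : Event n) (ρ : Record n) : Prop :=
  (st e.1 (e.2 + 1)).hist = (st e.1 e.2).hist ++ [ρ]

/-- `e` is a send event. -/
def IsSend {n : ℕ} (st : Fin n → ℕ → LocalState n) (e : Event n) : Prop :=
  ∃ j v, Appends st e (.sent j v)

/-- `e` is a receive event. -/
def IsRecv {n : ℕ} (st : Fin n → ℕ → LocalState n) (e : Event n) : Prop :=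
  ∃ j v, Appends st e (.received j v)

/-- `e` is an internal event. -/
def IsInternal {n : ℕ} (st : Fin n → ℕ → LocalState n) (e : Event n) : Prop :=
  (st e.1 (e.2 + 1)).hist = (st e.1 e.2).hist

/-- Lamport causality: the smallest transitive relation containing the local orders and the
pairs (matching send, receive). -/
def Causes {n : ℕ} (st : Fin n → ℕ → LocalState n) (δ : Event n → Event n) :
    Event n → Event n → Prop :=
  Relation.TransGen fun e e' => (e.1 = e'.1 ∧ e.2 < e'.2) ∨ (IsRecv st e' ∧ δ e' = e)

/-- A (global) run: an infinite sequence of local states for each process and a matching function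
from receive events to send events. The values of `δ` at other events carry no meaning. -/
structure Run (n : ℕ) : Type where
  /-- `st i k` is the `k`-th local state of process `i` -/
  st : Fin n → ℕ → LocalState n
  /-- the matching function -/
  δ : Event n → Event n
  event_kind : ∀ e, IsSend st e ∨ IsRecv st e ∨ IsInternal st e
  δ_inj : Set.InjOn δ {e | IsRecv st e}
  δ_spec : ∀ (e : Event n) (i : Fin n) (v : ℤ), Appends st e (.received i v) →
    (δ e).1 = i ∧ Appends st (δ e) (.sent e.1 v)
  causes_irrefl : ∀ e, ¬ Causes st δ e e

/-- A send event is matched if some receive event is mapped to it. -/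
def Run.Matched {n : ℕ} (r : Run n) (e : Event n) : Prop :=
  ∃ e', IsRecv r.st e' ∧ r.δ e' = e

/-- The class of runs with reliable, possibly reordering, communication: no unmatched send event
is succeeded by infinitely many matched send events on the same channel. -/
def RelRuns (n : ℕ) : Set (Run n) :=
  {r | ∀ (i j : Fin n) (k : ℕ), (∃ v, Appends r.st (i, k) (.sent j v)) → ¬ r.Matched (i, k) →
    {k' : ℕ | k < k' ∧ (∃ v, Appends r.st (i, k') (.sent j v)) ∧ r.Matched (i, k')}.Finite}

/-! ### Cuts and the semantics of programs -/

/-- The index family of a cut. -/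
abbrev Cut (n : ℕ) : Type := Fin n → ℕ∞

/-- A cut is finite if all its components are. -/
def Cut.IsFinite {n : ℕ} (c : Cut n) : Prop := ∀ i, c i ≠ ⊤

/-- The event `e` is in the cut `c`. -/
def Event.In {n : ℕ} (e : Event n) (c : Cut n) : Prop := (e.2 : ℕ∞) < c e.1

/-- No communication event in the cut is matched with an event outside the cut. -/
def Run.SilentAt {n : ℕ} (r : Run n) (c : Cut n) : Prop :=
  ∀ e, IsRecv r.st e → (Event.In e c ↔ Event.In (r.δ e) c)

/-- The formula `φ` holds at the cut `c`, where the variables of the processes in `U` and of the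
processes with an infinite component are unspecified, i.e. may take arbitrary values. -/
def Run.HoldsAt {n : ℕ} (r : Run n) (U : Set (Fin n)) (c : Cut n) (φ : Formula n) : Prop :=
  ∃ σ : Fin n → ℕ → ℤ, (∀ i, i ∉ U → ∀ k : ℕ, c i = k → σ i = (r.st i k).vars) ∧ φ.eval σ

/-- Process `i` performs one event between the cuts `c` and `d`, which changes its local state
according to `R`. If `i` has already performed infinitely many events at `c`, then `∞ + 1 = ∞`
and nothing is required of the (non-existent) state at `∞`. -/
def Run.Step {n : ℕ} (r : Run n) (i : Fin n) (R : LocalState n → LocalState n → Prop)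
    (c d : Cut n) : Prop :=
  d = Function.update c i (c i + 1) ∧ ∀ k : ℕ, c i = k → R (r.st i k) (r.st i (k + 1))

/-- Effect of an assignment on the local state. -/
def assignEffect {n : ℕ} (x : ℕ) (e : Expr) (s t : LocalState n) : Prop :=
  t = ⟨Function.update s.vars x (e.eval s.vars), s.hist⟩

/-- Effect of a send to `j` on the local state. -/
def sendEffect {n : ℕ} (j : Fin n) (e : Expr) (s t : LocalState n) : Prop :=
  t = ⟨s.vars, s.hist ++ [.sent j (e.eval s.vars)]⟩

/-- Effect of a receive from `j` on the local state. -/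
def recvEffect {n : ℕ} (j : Fin n) (x : ℕ) (s t : LocalState n) : Prop :=
  ∃ v : ℤ, t = ⟨Function.update s.vars x v, s.hist ++ [.received j v]⟩

/-- `Occurs r P c d`: the program `P` occurs over the interval `r[c,d]`. -/
def Occurs {n : ℕ} (r : Run n) : Prog n → Cut n → Cut n → Prop
  | .skip, c, d => c = d
  | .assign i x e, c, d => r.Step i (assignEffect x e) c d
  | .send i j e, c, d => r.Step i (sendEffect j e) c d
  | .recv i j x, c, d => r.Step i (recvEffect j x) c d
  | .guard φ, c, d => c = d ∧ r.HoldsAt ∅ c φ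
  | .silent, c, d => c = d ∧ r.SilentAt c
  | .layer P Q, c, d => ∃ c', c ≤ c' ∧ c' ≤ d ∧ Occurs r P c c' ∧ Occurs r Q c' d
  | .choice P Q, c, d => Occurs r P c d ∨ Occurs r Q c d
  | .rpt P, c, d =>
      (∃ (m : ℕ) (s : ℕ → Cut n), s 0 = c ∧ s m = d ∧
        ∀ k < m, s k ≤ s (k + 1) ∧ Occurs r P (s k) (s (k + 1))) ∨
      (∃ s : ℕ → Cut n, s 0 = c ∧ IsLUB (Set.range s) d ∧
        ∀ k, s k ≤ s (k + 1) ∧ Occurs r P (s k) (s (k + 1)))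

/-- `P` refines `Q` in `Γ`. -/
def Refines {n : ℕ} (Γ : Set (Run n)) (P Q : Prog n) : Prop :=
  ∀ r ∈ Γ, ∀ c d : Cut n, c ≤ d → Occurs r P c d → Occurs r Q c d

/-! ### Deadlock-freedom -/

/-- The cut with finite components `c`. -/
def finCut {n : ℕ} (c : Fin n → ℕ) : Cut n := fun i => (c i : ℕ∞)

/-- `Partial r P c H d H'`: a partial execution of `P` leads from `c` to `d`, both finite.
The processes in `H` have stopped before `P`; the processes in `H' ⊇ H` have stopped before or
during `P`. A stopped process performs none of its remaining statements. A guard is subject to the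
values of the processes that have reached it (there is no condition if none has); a silent cut is
checked once all processes have reached it. -/
def Partial {n : ℕ} (r : Run n) :
    Prog n → (Fin n → ℕ) → Set (Fin n) → (Fin n → ℕ) → Set (Fin n) → Prop
  | .skip, c, H, d, H' => H ⊆ H' ∧ c = d
  | .assign i x e, c, H, d, H' => H ⊆ H' ∧
      ((i ∈ H' ∧ c = d) ∨ (i ∉ H' ∧ r.Step i (assignEffect x e) (finCut c) (finCut d)))
  | .send i j e, c, H, d, H' => H ⊆ H' ∧
      ((i ∈ H' ∧ c = d) ∨ (i ∉ H' ∧ r.Step i (sendEffect j e) (finCut c) (finCut d)))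
  | .recv i j x, c, H, d, H' => H ⊆ H' ∧
      ((i ∈ H' ∧ c = d) ∨ (i ∉ H' ∧ r.Step i (recvEffect j x) (finCut c) (finCut d)))
  | .guard φ, c, H, d, H' => H ⊆ H' ∧ c = d ∧ (H' = Set.univ ∨ r.HoldsAt H' (finCut c) φ)
  | .silent, c, H, d, H' => H ⊆ H' ∧ c = d ∧ (H'.Nonempty ∨ r.SilentAt (finCut c))
  | .layer P Q, c, H, d, H' => ∃ c₁ H₁, Partial r P c H c₁ H₁ ∧ Partial r Q c₁ H₁ d H'
  | .choice P Q, c, H, d, H' => Partial r P c H d H' ∨ Partial r Q c H d H'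
  | .rpt P, c, H, d, H' =>
      ∃ (m : ℕ) (s : ℕ → Fin n → ℕ) (h : ℕ → Set (Fin n)), s 0 = c ∧ h 0 = H ∧ s m = d ∧ h m = H' ∧
        ∀ k < m, Partial r P (s k) (h k) (s (k + 1)) (h (k + 1))

/-- Every message received in the cut was sent in the cut. -/
def Run.ClosedAt {n : ℕ} (r : Run n) (c : Cut n) : Prop :=
  ∀ e, IsRecv r.st e → Event.In e c → Event.In (r.δ e) c

/-- The runs `r` and `r'` agree up to the finite cut `d`. -/
def AgreeUpTo {n : ℕ} (r r' : Run n) (d : Fin n → ℕ) : Prop :=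
  (∀ i, ∀ k ≤ d i, r'.st i k = r.st i k) ∧
    ∀ e, IsRecv r.st e → Event.In e (finCut d) → r'.δ e = r.δ e

/-- `P` is deadlock-free in `Γ`: started with empty channels and run in isolation, it cannot get
stuck, i.e. every partial execution can be continued to a (terminating or infinite) execution
of `P`. -/
def DeadlockFree {n : ℕ} (Γ : Set (Run n)) (P : Prog n) : Prop :=
  ∀ r ∈ Γ, ∀ (c d : Fin n → ℕ) (H : Set (Fin n)),
    r.SilentAt (finCut c) → Partial r P c ∅ d H → r.ClosedAt (finCut d) →
    ∃ r' ∈ Γ, ∃ d' : Cut n, AgreeUpTo r r' d ∧ finCut d ≤ d' ∧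
      Occurs r' (.layer .silent P) (finCut c) d' ∧ r'.ClosedAt d'

/-! ### Seals -/

/-- `S` seals `P` in `Γ`. -/
def Seals {n : ℕ} (Γ : Set (Run n)) (S P : Prog n) : Prop :=
  Refines Γ (.layer .silent (.layer P S)) (.layer P (.layer .silent S))

/-- `S` is a proper seal of `P` in `Γ`: it seals `P` and never diverges after `P`. -/
def ProperlySeals {n : ℕ} (Γ : Set (Run n)) (S P : Prog n) : Prop :=
  Seals Γ S P ∧ ∀ r ∈ Γ, ∀ c d d' : Cut n, Occurs r (.layer .silent P) c d →
    Occurs r (.layer .silent S) d d' → d.IsFinite → d'.IsFinite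

/-- The program consists of executable statements only: it does not contain the silent cut, which
is a specification of the channel contents. -/
def Prog.Executable {n : ℕ} : Prog n → Prop
  | .silent => False
  | .layer P Q => P.Executable ∧ Q.Executable
  | .choice P Q => P.Executable ∧ Q.Executable
  | .rpt P => P.Executable
  | _ => True

/-- `P` can be sealed in `Γ`: there is an executable program `S` that properly seals `P`, where
`S` and `P` followed by `S` are deadlock-free. -/
def Sealable {n : ℕ} (Γ : Set (Run n)) (P : Prog n) : Prop :=
  ∃ S : Prog n, S.Executable ∧ DeadlockFree Γ S ∧ DeadlockFree Γ (.layer P S) ∧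
    ProperlySeals Γ S P

/-! ### Numbering of programs -/

/-- Number of an expression. -/
def Expr.code : Expr → ℕ
  | .const z => Nat.pair 0 (Encodable.encode z)
  | .var x => Nat.pair 1 x
  | .add a b => Nat.pair 2 (Nat.pair a.code b.code)
  | .sub a b => Nat.pair 3 (Nat.pair a.code b.code)
  | .mul a b => Nat.pair 4 (Nat.pair a.code b.code)

/-- Number of a formula. -/
def Formula.code {n : ℕ} : Formula n → ℕ
  | .eq i a j b => Nat.pair 0 (Nat.pair (Nat.pair i a.code) (Nat.pair j b.code))
  | .lt i a j b => Nat.pair 1 (Nat.pair (Nat.pair i a.code) (Nat.pair j b.code))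
  | .not φ => Nat.pair 2 φ.code
  | .and φ ψ => Nat.pair 3 (Nat.pair φ.code ψ.code)
  | .or φ ψ => Nat.pair 4 (Nat.pair φ.code ψ.code)

/-- Number of a program. -/
def Prog.code {n : ℕ} : Prog n → ℕ
  | .skip => Nat.pair 0 0
  | .assign i x e => Nat.pair 1 (Nat.pair i (Nat.pair x e.code))
  | .send i j e => Nat.pair 2 (Nat.pair i (Nat.pair j e.code))
  | .recv i j x => Nat.pair 3 (Nat.pair i (Nat.pair j x))
  | .guard φ => Nat.pair 4 φ.code
  | .silent => Nat.pair 5 0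
  | .layer P Q => Nat.pair 6 (Nat.pair P.code Q.code)
  | .choice P Q => Nat.pair 7 (Nat.pair P.code Q.code)
  | .rpt P => Nat.pair 8 P.code

theorem Expr.code_injective : Function.Injective Expr.code := by
  intro a
  induction a with
  | const z => intro b h; cases b <;> simp_all [Expr.code, Nat.pair_eq_pair]
  | var x => intro b h; cases b <;> simp_all [Expr.code, Nat.pair_eq_pair]
  | add a b iha ihb =>
    intro c h; cases c <;> simp [Expr.code, Nat.pair_eq_pair] at h
    exact congrArg₂ _ (iha h.1) (ihb h.2)
  | sub a b iha ihb =>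
    intro c h; cases c <;> simp [Expr.code, Nat.pair_eq_pair] at h
    exact congrArg₂ _ (iha h.1) (ihb h.2)
  | mul a b iha ihb =>
    intro c h; cases c <;> simp [Expr.code, Nat.pair_eq_pair] at h
    exact congrArg₂ _ (iha h.1) (ihb h.2)

theorem Formula.code_injective {n : ℕ} : Function.Injective (Formula.code (n := n)) := by
  intro φ
  induction φ with
  | eq i a j b =>
    intro c h; cases c <;> simp [Formula.code, Nat.pair_eq_pair] at h
    obtain ⟨⟨h1, h2⟩, h3, h4⟩ := h
    rw [Fin.ext h1, Expr.code_injective h2, Fin.ext h3, Expr.code_injective h4]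
  | lt i a j b =>
    intro c h; cases c <;> simp [Formula.code, Nat.pair_eq_pair] at h
    obtain ⟨⟨h1, h2⟩, h3, h4⟩ := h
    rw [Fin.ext h1, Expr.code_injective h2, Fin.ext h3, Expr.code_injective h4]
  | not φ ih =>
    intro c h; cases c <;> simp [Formula.code, Nat.pair_eq_pair] at h
    exact congrArg _ (ih h)
  | and φ ψ ih1 ih2 =>
    intro c h; cases c <;> simp [Formula.code, Nat.pair_eq_pair] at h
    exact congrArg₂ _ (ih1 h.1) (ih2 h.2)
  | or φ ψ ih1 ih2 =>
    intro c h; cases c <;> simp [Formula.code, Nat.pair_eq_pair] at h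
    exact congrArg₂ _ (ih1 h.1) (ih2 h.2)

/-- Different programs have different numbers. -/
theorem Prog.code_injective {n : ℕ} : Function.Injective (Prog.code (n := n)) := by
  intro P
  induction P with
  | skip => intro c h; cases c <;> simp_all [Prog.code, Nat.pair_eq_pair]
  | silent => intro c h; cases c <;> simp_all [Prog.code, Nat.pair_eq_pair]
  | assign i x e =>
    intro c h; cases c <;> simp [Prog.code, Nat.pair_eq_pair] at h
    rw [Fin.ext h.1, h.2.1, Expr.code_injective h.2.2]
  | send i j e =>
    intro c h; cases c <;> simp [Prog.code, Nat.pair_eq_pair] at h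
    rw [Fin.ext h.1, Fin.ext h.2.1, Expr.code_injective h.2.2]
  | recv i j x =>
    intro c h; cases c <;> simp [Prog.code, Nat.pair_eq_pair] at h
    rw [Fin.ext h.1, Fin.ext h.2.1, h.2.2]
  | guard φ =>
    intro c h; cases c <;> simp [Prog.code, Nat.pair_eq_pair] at h
    rw [Formula.code_injective h]
  | layer P Q ih1 ih2 =>
    intro c h; cases c <;> simp [Prog.code, Nat.pair_eq_pair] at h
    exact congrArg₂ _ (ih1 h.1) (ih2 h.2)
  | choice P Q ih1 ih2 =>
    intro c h; cases c <;> simp [Prog.code, Nat.pair_eq_pair] at h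
    exact congrArg₂ _ (ih1 h.1) (ih2 h.2)
  | rpt P ih =>
    intro c h; cases c <;> simp [Prog.code, Nat.pair_eq_pair] at h
    exact congrArg _ (ih h)

end Sealing

namespace Sealing

/-! ### Events and extensions of runs -/

/-! The halting problem is reduced to sealability, with a single process `p` that sends only to
itself. From a partial recursive `u` and an input `k` one obtains a command `M` that searches
nondeterministically for a computation of `u k`; a failed test does not block, but makes variable 1
nonzero for good. The program `reporting p M` executes `M` and then sends one message to `p` if
variable 1 is zero. It never blocks and never receives, so it is deadlock-free whether or not `u k`
is defined (`deadlockFree_reporting`).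

If `u k` is undefined, no terminating execution sends the message and a diverging one never reaches
the send. The silence of the initial cut is preserved, and the empty program is a proper seal
(`sealable_reporting`).

If `u k` is defined, let `S` be a seal (`not_sealable_reporting`), and take a run in which the
message has just been sent, at a finite cut `d`. Deadlock-freedom of the program followed by `S`
yields a complete execution up to some `d'`. Sealing yields a silent cut at which the program ends;
variable 0, which marks the end of `M`, forces this cut to be `d` (`eq_of_occurs_reporting`).
Properness makes `d'` finite. Silence at `d` tolerates the message only as one that is never
received, since a receipt inside `d` would not come after its send. But `S` cannot prevent a later
receipt: let `p` receive the message right after `d'` (`Run.exists_receive`). Executable programs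
only depend on the local states up to `d'` (`Prog.Executable.occurs_congr`), so both still occur,
while `d` is no longer silent. This contradicts sealing.

That commands suffice to compute every partial recursive function (`TestCmd.exists_computes`) is
shown by induction on `Nat.Partrec`, with case distinctions and loop bounds replaced by guessing and
subsequent tests. -/

theorem IsRecv.not_isInternal {n : ℕ} {st : Fin n → ℕ → LocalState n} {e : Event n}
    (h : IsRecv st e) : ¬ IsInternal st e := by
  obtain ⟨j, v, h⟩ := h
  intro h'
  have := congrArg List.length (h.symm.trans h')
  simp at this

theorem IsSend.not_isInternal {n : ℕ} {st : Fin n → ℕ → LocalState n} {e : Event n}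
    (h : IsSend st e) : ¬ IsInternal st e := by
  obtain ⟨j, v, h⟩ := h
  intro h'
  have := congrArg List.length (h.symm.trans h')
  simp at this

theorem IsRecv.not_isSend {n : ℕ} {st : Fin n → ℕ → LocalState n} {e : Event n}
    (h : IsRecv st e) : ¬ IsSend st e := by
  obtain ⟨j, v, h⟩ := h
  rintro ⟨j', v', h'⟩
  have := List.append_cancel_left (h.symm.trans h')
  simp at this

theorem event_in_finCut {n : ℕ} {e : Event n} {d : Fin n → ℕ} :
    Event.In e (finCut d) ↔ e.2 < d e.1 := by
  simp [Event.In, finCut]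

theorem appends_congr {n : ℕ} {st st' : Fin n → ℕ → LocalState n} {d : Fin n → ℕ}
    (h : ∀ i, ∀ k ≤ d i, st' i k = st i k) {e : Event n} (he : Event.In e (finCut d))
    (ρ : Record n) : Appends st' e ρ ↔ Appends st e ρ := by
  rw [event_in_finCut] at he
  unfold Appends
  rw [h _ _ he, h _ _ he.le]

theorem isRecv_congr {n : ℕ} {st st' : Fin n → ℕ → LocalState n} {d : Fin n → ℕ}
    (h : ∀ i, ∀ k ≤ d i, st' i k = st i k) {e : Event n} (he : Event.In e (finCut d)) :
    IsRecv st' e ↔ IsRecv st e := by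
  simp only [IsRecv, appends_congr h he]

/-- A run with finitely many receive events is reliable. -/
theorem mem_relRuns_of_finite {n : ℕ} (r : Run n) (h : {e | IsRecv r.st e}.Finite) :
    r ∈ RelRuns n := by
  intro i j k _ _
  refine ((h.image r.δ).image Prod.snd).subset ?_
  rintro k' ⟨_, _, e, he, hek⟩
  exact ⟨(i, k'), ⟨e, he, hek⟩, rfl⟩

/-- A run can be changed arbitrarily after a closed finite cut `d`, provided that at most one
message is received outside of `d`, and this message was sent but not received in `d`. -/
theorem Run.exists_extension {n : ℕ} (r : Run n) (d : Fin n → ℕ) (hd : r.ClosedAt (finCut d))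
    (st' : Fin n → ℕ → LocalState n) (δ' : Event n → Event n)
    (hst : ∀ i, ∀ k ≤ d i, st' i k = r.st i k)
    (hkind : ∀ e, ¬ Event.In e (finCut d) → IsSend st' e ∨ IsRecv st' e ∨ IsInternal st' e)
    (hone : ∀ e e', ¬ Event.In e (finCut d) → ¬ Event.In e' (finCut d) →
      IsRecv st' e → IsRecv st' e' → e = e')
    (hspec : ∀ e, ¬ Event.In e (finCut d) → ∀ i v, Appends st' e (.received i v) →
      (δ' e).1 = i ∧ Appends st' (δ' e) (.sent e.1 v) ∧ Event.In (δ' e) (finCut d) ∧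
      ∀ e', IsRecv r.st e' → Event.In e' (finCut d) → r.δ e' ≠ δ' e) :
    ∃ r' ∈ RelRuns n, r'.st = st' ∧ (∀ e, Event.In e (finCut d) → r'.δ e = r.δ e) ∧
      ∀ e, ¬ Event.In e (finCut d) → r'.δ e = δ' e := by
  classical
  set δ : Event n → Event n := fun e => if Event.In e (finCut d) then r.δ e else δ' e with hδ
  have hin : ∀ e, Event.In e (finCut d) → δ e = r.δ e := fun e he => by simp [hδ, he]
  have hout : ∀ e, ¬ Event.In e (finCut d) → δ e = δ' e := fun e he => by simp [hδ, he]
  have hrecv : ∀ e, Event.In e (finCut d) → IsRecv st' e → IsRecv r.st e :=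
    fun e he h => (isRecv_congr hst he).1 h
  have hδin : ∀ e, IsRecv st' e → Event.In (δ e) (finCut d) := by
    intro e h
    by_cases he : Event.In e (finCut d)
    · rw [hin e he]
      exact hd e (hrecv e he h) he
    · rw [hout e he]
      obtain ⟨i, v, h⟩ := h
      exact (hspec e he i v h).2.2.1
  -- Every receipt, old or new, is matched with a send in `d`. So a causal chain that ends in `d`
  -- lies in `d` and is already present in `r`.
  have hback : ∀ e e', Causes st' δ e e' → Event.In e' (finCut d) →
      Event.In e (finCut d) ∧ Causes r.st r.δ e e' := by
    intro e e' h
    induction h with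
    | single h =>
      rename_i b
      intro hb
      have : Event.In e (finCut d) := by
        rcases h with ⟨h1, h2⟩ | ⟨h1, h2⟩
        · rw [event_in_finCut] at hb ⊢
          rw [h1]
          exact h2.trans hb
        · exact h2 ▸ hδin b h1
      refine ⟨this, .single ?_⟩
      rcases h with h | ⟨h1, h2⟩
      · exact Or.inl h
      · exact Or.inr ⟨hrecv b hb h1, by rw [← hin b hb, h2]⟩
    | tail _ h ih =>
      rename_i b b' _
      intro hb
      have : Event.In b (finCut d) := by
        rcases h with ⟨h1, h2⟩ | ⟨h1, h2⟩
        · rw [event_in_finCut] at hb ⊢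
          rw [h1]
          exact h2.trans hb
        · exact h2 ▸ hδin _ h1
      refine ⟨(ih this).1, .tail (ih this).2 ?_⟩
      rcases h with h | ⟨h1, h2⟩
      · exact Or.inl h
      · exact Or.inr ⟨hrecv _ hb h1, by rw [← hin _ hb, h2]⟩
  -- A chain that starts outside `d` never uses a matching pair, whose send lies in `d`; it only
  -- follows the local order of one process.
  have hforw : ∀ e e', Causes st' δ e e' → ¬ Event.In e (finCut d) → e.1 = e'.1 ∧ e.2 < e'.2 := by
    intro e e' h he
    induction h with
    | single h =>
      rcases h with h | ⟨h1, h2⟩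
      · exact h
      · exact absurd (h2 ▸ hδin _ h1) he
    | tail h' h ih =>
      rename_i b b'
      rcases h with h | ⟨h1, h2⟩
      · exact ⟨ih.1.trans h.1, ih.2.trans h.2⟩
      · exact absurd (hback _ _ h' (h2 ▸ hδin _ h1)).1 he
  refine ⟨⟨st', δ, ?_, ?_, ?_, ?_⟩, ?_, rfl, hin, hout⟩
  · intro e
    by_cases he : Event.In e (finCut d)
    · have := r.event_kind e
      rw [event_in_finCut] at he
      simpa only [IsSend, IsRecv, IsInternal, Appends, hst _ _ he, hst _ _ he.le] using this
    · exact hkind e he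
  · intro e h e' h' hee
    by_cases he : Event.In e (finCut d) <;> by_cases he' : Event.In e' (finCut d)
    · rw [hin e he, hin e' he'] at hee
      exact r.δ_inj (hrecv e he h) (hrecv e' he' h') hee
    · rw [hin e he, hout e' he'] at hee
      obtain ⟨i, v, h'⟩ := h'
      exact absurd hee ((hspec e' he' i v h').2.2.2 e (hrecv e he h) he)
    · rw [hout e he, hin e' he'] at hee
      obtain ⟨i, v, h⟩ := h
      exact absurd hee.symm ((hspec e he i v h).2.2.2 e' (hrecv e' he' h') he')
    · exact hone e e' he he' h h'
  · intro e i v h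
    by_cases he : Event.In e (finCut d)
    · have h1 := (appends_congr hst he _).1 h
      have h2 := r.δ_spec e i v h1
      rw [hin e he]
      exact ⟨h2.1, (appends_congr hst (hd e ⟨i, v, h1⟩ he) _).2 h2.2⟩
    · rw [hout e he]
      exact ⟨(hspec e he i v h).1, (hspec e he i v h).2.1⟩
  · intro e h
    by_cases he : Event.In e (finCut d)
    · exact r.causes_irrefl e (hback e e h he).2
    · exact lt_irrefl _ (hforw e e h he).2
  · apply mem_relRuns_of_finite
    have h1 : {e : Event n | Event.In e (finCut d)}.Finite := by
      refine (Set.finite_univ.biUnion (t := fun i : Fin n => Prod.mk i '' Set.Iio (d i))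
        fun i _ => (Set.finite_Iio _).image _).subset ?_
      rintro ⟨i, k⟩ h
      simpa [event_in_finCut] using h
    have h2 : {e : Event n | ¬ Event.In e (finCut d) ∧ IsRecv st' e}.Finite :=
      Set.Subsingleton.finite fun e h e' h' => hone e e' h.1 h'.1 h.2 h'.2
    refine (h1.union h2).subset fun e h => ?_
    by_cases he : Event.In e (finCut d)
    · exact Or.inl he
    · exact Or.inr ⟨he, h⟩

/-- The occurrence of an executable program only depends on the states up to the final cut. -/
theorem Prog.Executable.occurs_congr {n : ℕ} {r r' : Run n} {P : Prog n} (hP : P.Executable)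
    {c d : Cut n} (hcd : c ≤ d)
    (hst : ∀ i, ∀ k : ℕ, (k : ℕ∞) ≤ d i → r'.st i k = r.st i k)
    (h : Occurs r P c d) : Occurs r' P c d := by
  have step : ∀ (i : Fin n) (R : LocalState n → LocalState n → Prop) (c d : Cut n),
      (∀ i, ∀ k : ℕ, (k : ℕ∞) ≤ d i → r'.st i k = r.st i k) →
      r.Step i R c d → r'.Step i R c d := by
    rintro i R c d hst ⟨rfl, h⟩
    refine ⟨rfl, fun k hk => ?_⟩
    have h1 : ((k + 1 : ℕ) : ℕ∞) ≤ Function.update c i (c i + 1) i := by simp [hk]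
    rw [hst i k (le_trans (by simp) h1), hst i (k + 1) h1]
    exact h k hk
  induction P generalizing c d with
  | skip => exact h
  | assign i x e => exact step _ _ _ _ hst h
  | send i j e => exact step _ _ _ _ hst h
  | recv i j x => exact step _ _ _ _ hst h
  | guard φ =>
    obtain ⟨rfl, σ, h1, h2⟩ := h
    refine ⟨rfl, σ, fun i hi k hk => ?_, h2⟩
    rw [h1 i hi k hk, hst i k hk.ge]
  | silent => exact hP.elim
  | layer P Q ihP ihQ =>
    obtain ⟨c', h1, h2, h3, h4⟩ := h
    exact ⟨c', h1, h2, ihP hP.1 h1 (fun i k hk => hst i k (hk.trans (h2 i))) h3,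
      ihQ hP.2 h2 hst h4⟩
  | choice P Q ihP ihQ =>
    rcases h with h | h
    · exact Or.inl (ihP hP.1 hcd hst h)
    · exact Or.inr (ihQ hP.2 hcd hst h)
  | rpt P ih =>
    rcases h with ⟨m, s, h0, hm, h⟩ | ⟨s, h0, hm, h⟩
    · have hle : ∀ k ≤ m, s k ≤ d := by
        intro k hk
        rw [← hm]
        induction hk using Nat.decreasingInduction with
        | self => exact le_rfl
        | of_succ j hj ih' => exact (h j hj).1.trans ih'
      exact Or.inl ⟨m, s, h0, hm, fun k hk => ⟨(h k hk).1,
        ih hP (h k hk).1 (fun i j hj => hst i j (hj.trans (hle (k + 1) hk i))) (h k hk).2⟩⟩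
    · exact Or.inr ⟨s, h0, hm, fun k => ⟨(h k).1,
        ih hP (h k).1 (fun i j hj => hst i j (hj.trans (hm.1 ⟨k + 1, rfl⟩ i))) (h k).2⟩⟩

/-- All processes may stop before a program. -/
theorem partial_of_all_stopped {n : ℕ} (hn : 1 ≤ n) (r : Run n) (P : Prog n) (c : Fin n → ℕ)
    (H : Set (Fin n)) : Partial r P c H c Set.univ := by
  have hne : (Set.univ : Set (Fin n)).Nonempty := ⟨⟨0, hn⟩, trivial⟩
  induction P generalizing H with
  | skip => exact ⟨Set.subset_univ _, rfl⟩
  | assign i x e => exact ⟨Set.subset_univ _, Or.inl ⟨trivial, rfl⟩⟩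
  | send i j e => exact ⟨Set.subset_univ _, Or.inl ⟨trivial, rfl⟩⟩
  | recv i j x => exact ⟨Set.subset_univ _, Or.inl ⟨trivial, rfl⟩⟩
  | guard φ => exact ⟨Set.subset_univ _, rfl, Or.inl rfl⟩
  | silent => exact ⟨Set.subset_univ _, rfl, Or.inl hne⟩
  | layer P Q ihP ihQ => exact ⟨c, Set.univ, ihP H, ihQ Set.univ⟩
  | choice P Q ihP ihQ => exact Or.inl (ihP H)
  | rpt P ih =>
    -- One round, not zero: the processes need an iteration in which to stop.
    refine ⟨1, fun _ => c, fun k => if k = 0 then H else Set.univ, rfl, by simp, rfl, by simp, ?_⟩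
    intro k hk
    obtain rfl : k = 0 := by omega
    simpa using ih H

/-! ### Commands of a single process -/

/-- Programs of one process which neither communicate nor block. -/
inductive Cmd : Type
  | assign (x : ℕ) (e : Expr)
  | seq (A B : Cmd)
  | choice (A B : Cmd)
  | star (A : Cmd)

namespace Cmd

/-- The command as a program of process `p`. -/
def toProg {n : ℕ} (p : Fin n) : Cmd → Prog n
  | .assign x e => .assign p x e
  | .seq A B => .layer (A.toProg p) (B.toProg p)
  | .choice A B => .choice (A.toProg p) (B.toProg p)
  | .star A => .rpt (A.toProg p)

/-- The command does not assign to the variable `x`. -/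
def Keeps (x : ℕ) : Cmd → Prop
  | .assign y _ => x ≠ y
  | .seq A B => A.Keeps x ∧ B.Keeps x
  | .choice A B => A.Keeps x ∧ B.Keeps x
  | .star A => A.Keeps x

/-- The terminating executions of a command, as a relation between valuations. -/
def Rel : Cmd → (ℕ → ℤ) → (ℕ → ℤ) → Prop
  | .assign x e => fun σ τ => τ = Function.update σ x (e.eval σ)
  | .seq A B => Relation.Comp A.Rel B.Rel
  | .choice A B => fun σ τ => A.Rel σ τ ∨ B.Rel σ τ
  | .star A => Relation.ReflTransGen A.Rel

/-- The command is executed along the sequence `f` of local states between the indices `a`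
and `b`. -/
def Seg {n : ℕ} (f : ℕ → LocalState n) : Cmd → ℕ → ℕ → Prop
  | .assign x e => fun a b => b = a + 1 ∧ assignEffect x e (f a) (f (a + 1))
  | .seq A B => Relation.Comp (A.Seg f) (B.Seg f)
  | .choice A B => fun a b => A.Seg f a b ∨ B.Seg f a b
  | .star A => Relation.ReflTransGen (A.Seg f)

/-- The event `k` in the sequence `f` is internal and changes at most the variables assigned by
the command. -/
def Quiet {n : ℕ} (C : Cmd) (f : ℕ → LocalState n) (k : ℕ) : Prop :=
  (f (k + 1)).hist = (f k).hist ∧ ∀ x, C.Keeps x → (f (k + 1)).vars x = (f k).vars x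

theorem Quiet.of_keeps {n : ℕ} {A C : Cmd} {f : ℕ → LocalState n} {k : ℕ}
    (h : ∀ x, C.Keeps x → A.Keeps x) (hA : A.Quiet f k) : C.Quiet f k :=
  ⟨hA.1, fun x hx => hA.2 x (h x hx)⟩

theorem quiet_of_assignEffect {n : ℕ} {x : ℕ} {e : Expr} {f : ℕ → LocalState n} {k : ℕ}
    (h : assignEffect x e (f k) (f (k + 1))) : (assign x e).Quiet f k := by
  unfold assignEffect at h
  rw [Quiet, h]
  exact ⟨rfl, fun y hy => Function.update_of_ne hy _ _⟩

theorem Seg.le {n : ℕ} {f : ℕ → LocalState n} {C : Cmd} {a b : ℕ} (h : C.Seg f a b) : a ≤ b := by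
  induction C generalizing a b with
  | assign x e => exact h.1 ▸ Nat.le_succ a
  | seq A B ihA ihB =>
    obtain ⟨m, h1, h2⟩ := h
    exact (ihA h1).trans (ihB h2)
  | choice A B ihA ihB => exact h.elim ihA ihB
  | star A ih =>
    change Relation.ReflTransGen _ _ _ at h
    induction h with
    | refl => exact le_rfl
    | tail _ h ih' => exact ih'.trans (ih h)

theorem Seg.congr {n : ℕ} {f g : ℕ → LocalState n} {C : Cmd} {a b : ℕ} (h : C.Seg f a b)
    (hfg : ∀ k ≤ b, g k = f k) : C.Seg g a b := by
  induction C generalizing a b with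
  | assign x e =>
    obtain ⟨rfl, h⟩ := h
    exact ⟨rfl, by rwa [hfg _ (Nat.le_succ a), hfg _ le_rfl]⟩
  | seq A B ihA ihB =>
    obtain ⟨m, h1, h2⟩ := h
    exact ⟨m, ihA h1 fun k hk => hfg k (hk.trans h2.le), ihB h2 hfg⟩
  | choice A B ihA ihB => exact h.imp (ihA · hfg) (ihB · hfg)
  | star A ih =>
    change Relation.ReflTransGen _ _ _ at h
    induction h with
    | refl => exact .refl
    | tail _ h ih' => exact .tail (ih' fun k hk => hfg k (hk.trans h.le)) (ih h hfg)

theorem Seg.quiet {n : ℕ} {f : ℕ → LocalState n} {C : Cmd} {a b : ℕ} (h : C.Seg f a b) {k : ℕ}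
    (hak : a ≤ k) (hkb : k < b) : C.Quiet f k := by
  induction C generalizing a b with
  | assign x e =>
    obtain ⟨rfl, h⟩ := h
    obtain rfl : a = k := by omega
    exact quiet_of_assignEffect h
  | seq A B ihA ihB =>
    obtain ⟨m, h1, h2⟩ := h
    rcases lt_or_ge k m with hk | hk
    · exact (ihA h1 hak hk).of_keeps fun x hx => hx.1
    · exact (ihB h2 hk hkb).of_keeps fun x hx => hx.2
  | choice A B ihA ihB =>
    rcases h with h | h
    · exact (ihA h hak hkb).of_keeps fun x hx => hx.1
    · exact (ihB h hak hkb).of_keeps fun x hx => hx.2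
  | star A ih =>
    change Relation.ReflTransGen _ _ _ at h
    induction h with
    | refl => omega
    | tail _ h ih' =>
      rename_i m b _
      rcases lt_or_ge k m with hk | hk
      · exact ih' hk
      · exact ih h hk hkb

theorem Seg.rel {n : ℕ} {f : ℕ → LocalState n} {C : Cmd} {a b : ℕ} (h : C.Seg f a b) :
    C.Rel (f a).vars (f b).vars := by
  induction C generalizing a b with
  | assign x e =>
    obtain ⟨rfl, h⟩ := h
    exact congrArg LocalState.vars h
  | seq A B ihA ihB =>
    obtain ⟨m, h1, h2⟩ := h
    exact ⟨_, ihA h1, ihB h2⟩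
  | choice A B ihA ihB => exact h.imp ihA ihB
  | star A ih =>
    change Relation.ReflTransGen _ _ _ at h
    induction h with
    | refl => exact .refl
    | tail _ h ih' => exact .tail ih' (ih h)

/-- Every execution on valuations can be appended to a given sequence of local states. -/
theorem Rel.exists_seg {n : ℕ} {C : Cmd} {σ τ : ℕ → ℤ} (h : C.Rel σ τ) (f : ℕ → LocalState n)
    (a : ℕ) (hf : (f a).vars = σ) :
    ∃ (g : ℕ → LocalState n) (b : ℕ), (∀ k ≤ a, g k = f k) ∧ C.Seg g a b ∧ (g b).vars = τ := by
  induction C generalizing σ τ f a with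
  | assign x e =>
    refine ⟨fun k => if k ≤ a then f k else ⟨τ, (f a).hist⟩, a + 1, fun k hk => by simp [hk],
      ⟨rfl, ?_⟩, by simp⟩
    change τ = _ at h
    simp [assignEffect, h, hf]
  | seq A B ihA ihB =>
    obtain ⟨ρ, h1, h2⟩ := h
    obtain ⟨g, m, hg, hgA, hgm⟩ := ihA h1 f a hf
    obtain ⟨g', b, hg', hgB, hgb⟩ := ihB h2 g m hgm
    exact ⟨g', b, fun k hk => (hg' k (hk.trans hgA.le)).trans (hg k hk),
      ⟨m, hgA.congr hg', hgB⟩, hgb⟩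
  | choice A B ihA ihB =>
    rcases h with h | h
    · obtain ⟨g, b, h1, h2, h3⟩ := ihA h f a hf
      exact ⟨g, b, h1, Or.inl h2, h3⟩
    · obtain ⟨g, b, h1, h2, h3⟩ := ihB h f a hf
      exact ⟨g, b, h1, Or.inr h2, h3⟩
  | star A ih =>
    change Relation.ReflTransGen _ _ _ at h
    induction h with
    | refl => exact ⟨f, a, fun _ _ => rfl, .refl, hf⟩
    | tail _ h ih' =>
      obtain ⟨g, m, hg, hgA, hgm⟩ := ih'
      obtain ⟨g', b, hg', hgB, hgb⟩ := ih h g m hgm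
      exact ⟨g', b, fun k hk => (hg' k (hk.trans hgA.le)).trans (hg k hk),
        .tail (hgA.congr hg') hgB, hgb⟩

/-- Commands contain no guard or receive, and a star may end after zero rounds, so they can always
terminate. Deadlock-freedom rests on this. -/
theorem exists_rel (C : Cmd) (σ : ℕ → ℤ) : ∃ τ, C.Rel σ τ := by
  induction C generalizing σ with
  | assign x e => exact ⟨_, rfl⟩
  | seq A B ihA ihB =>
    obtain ⟨ρ, h1⟩ := ihA σ
    obtain ⟨τ, h2⟩ := ihB ρ
    exact ⟨τ, ρ, h1, h2⟩
  | choice A B ihA ihB => exact (ihA σ).imp fun τ h => Or.inl h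
  | star A ih => exact ⟨σ, .refl⟩

theorem exists_seg {n : ℕ} (C : Cmd) (f : ℕ → LocalState n) (a : ℕ) :
    ∃ (g : ℕ → LocalState n) (b : ℕ), (∀ k ≤ a, g k = f k) ∧ C.Seg g a b := by
  obtain ⟨τ, h⟩ := C.exists_rel (f a).vars
  obtain ⟨g, b, h1, h2, -⟩ := h.exists_seg f a rfl
  exact ⟨g, b, h1, h2⟩

/-- What the occurrence of a command of process `p` over `r[c,d]` says about the states of `p`. -/
structure Trace {n : ℕ} (C : Cmd) (r : Run n) (p : Fin n) (c d : Cut n) : Prop where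
  other : ∀ i, i ≠ p → d i = c i
  le : c p ≤ d p
  seg : ∀ a b : ℕ, c p = a → d p = b → C.Seg (r.st p) a b
  quiet : ∀ k : ℕ, c p ≤ k → (k : ℕ∞) < d p → C.Quiet (r.st p) k

theorem Trace.star_refl {n : ℕ} {A : Cmd} {r : Run n} {p : Fin n} (c : Cut n) :
    (star A).Trace r p c c where
  other _ _ := rfl
  le := le_rfl
  seg a b ha hb := by
    obtain rfl : a = b := by exact_mod_cast ha.symm.trans hb
    exact .refl
  quiet k h1 h2 := absurd h1 h2.not_ge

theorem Trace.star_tail {n : ℕ} {A : Cmd} {r : Run n} {p : Fin n} {c c' d : Cut n}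
    (h1 : (star A).Trace r p c c') (h2 : A.Trace r p c' d) : (star A).Trace r p c d where
  other i hi := (h2.other i hi).trans (h1.other i hi)
  le := h1.le.trans h2.le
  seg a b ha hb := by
    obtain ⟨m, hm⟩ := ENat.ne_top_iff_exists.1 (ne_top_of_le_ne_top (hb ▸ ENat.natCast_ne_top b) h2.le)
    exact .tail (h1.seg a m ha hm.symm) (h2.seg m b hm.symm hb)
  quiet k hk hk' := by
    rcases lt_or_ge (k : ℕ∞) (c' p) with h | h
    · exact h1.quiet k hk h
    · exact h2.quiet k h hk'

theorem Trace.star_sequence {n : ℕ} {A : Cmd} {r : Run n} {p : Fin n} {s : ℕ → Cut n} {m : ℕ}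
    (h : ∀ k < m, A.Trace r p (s k) (s (k + 1))) : (star A).Trace r p (s 0) (s m) := by
  induction m with
  | zero => exact Trace.star_refl _
  | succ m ih => exact (ih fun k hk => h k (by omega)).star_tail (h m (Nat.lt_succ_self m))

/-- A finite supremum of components is attained, so infinitely many rounds that end at a finite
index of `p` amount to finitely many. If the supremum is infinite, only `quiet` carries information,
and each event is already covered by a finite stage. -/
theorem Trace.star_isLUB {n : ℕ} {A : Cmd} {r : Run n} {p : Fin n} {s : ℕ → Cut n} {d : Cut n}
    (h : ∀ m, (star A).Trace r p (s 0) (s m)) (hd : IsLUB (Set.range s) d) :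
    (star A).Trace r p (s 0) d := by
  have hd' : ∀ i, IsLUB (Set.range fun m => s m i) (d i) := by
    intro i
    have := (isLUB_pi.1 hd) i
    rwa [← Set.range_comp] at this
  refine ⟨fun i hi => ?_, (hd' p).1 ⟨0, rfl⟩, fun a b ha hb => ?_, fun k hk hk' => ?_⟩
  · have : (Set.range fun m => s m i) = {s 0 i} := by
      ext x
      simp [fun m => (h m).other i hi]
    exact (hd' i).unique (this ▸ isLUB_singleton)
  · obtain ⟨m, hm⟩ : ∃ m, s m p = b := by
      by_contra! hne
      have hlt : ∀ m, s m p < b := fun m => lt_of_le_of_ne (hb ▸ (hd' p).1 ⟨m, rfl⟩) (hne m)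
      have hb0 : b ≠ 0 := by
        rintro rfl
        exact absurd (hlt 0) (by simp)
      have : d p ≤ ((b - 1 : ℕ) : ℕ∞) := by
        refine (hd' p).2 ?_
        rintro _ ⟨m, rfl⟩
        have := hlt m
        obtain ⟨x, hx⟩ := ENat.ne_top_iff_exists.1 this.ne_top
        simp only [← hx] at this ⊢
        norm_cast at this ⊢
        omega
      rw [hb] at this
      norm_cast at this
      omega
    exact (h m).seg a b ha hm
  · obtain ⟨_, ⟨m, rfl⟩, hm⟩ := (lt_isLUB_iff (hd' p)).1 hk'
    exact (h m).quiet k hk hm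

/-- `seg` speaks of finite ends only. For a diverging execution there remains `quiet`: its events
are internal and respect the variables that the command keeps. -/
theorem trace_of_occurs {n : ℕ} {C : Cmd} {r : Run n} {p : Fin n} {c d : Cut n}
    (h : Occurs r (C.toProg p) c d) : C.Trace r p c d := by
  induction C generalizing c d with
  | assign x e =>
    obtain ⟨rfl, h⟩ := h
    refine ⟨fun i hi => Function.update_of_ne hi _ _, by simp, fun a b ha hb => ?_,
      fun k hk hk' => ?_⟩
    · simp only [Function.update_self, ha] at hb
      exact ⟨by exact_mod_cast hb.symm, h a ha⟩
    · simp only [Function.update_self] at hk'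
      obtain ⟨a, ha⟩ := ENat.ne_top_iff_exists.1 (ne_top_of_le_ne_top (ENat.natCast_ne_top k) hk)
      rw [← ha] at hk hk'
      norm_cast at hk hk'
      obtain rfl : a = k := by omega
      exact quiet_of_assignEffect (h a ha.symm)
  | seq A B ihA ihB =>
    obtain ⟨c', _, _, h1, h2⟩ := h
    replace h1 := ihA h1
    replace h2 := ihB h2
    refine ⟨fun i hi => (h2.other i hi).trans (h1.other i hi), h1.le.trans h2.le,
      fun a b ha hb => ?_, fun k hk hk' => ?_⟩
    · obtain ⟨m, hm⟩ :=
        ENat.ne_top_iff_exists.1 (ne_top_of_le_ne_top (hb ▸ ENat.natCast_ne_top b) h2.le)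
      exact ⟨m, h1.seg a m ha hm.symm, h2.seg m b hm.symm hb⟩
    · rcases lt_or_ge (k : ℕ∞) (c' p) with h | h
      · exact (h1.quiet k hk h).of_keeps fun x hx => hx.1
      · exact (h2.quiet k h hk').of_keeps fun x hx => hx.2
  | choice A B ihA ihB =>
    rcases h with h | h
    · have h := ihA h
      exact ⟨h.other, h.le, fun a b ha hb => Or.inl (h.seg a b ha hb),
        fun k hk hk' => (h.quiet k hk hk').of_keeps fun x hx => hx.1⟩
    · have h := ihB h
      exact ⟨h.other, h.le, fun a b ha hb => Or.inr (h.seg a b ha hb),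
        fun k hk hk' => (h.quiet k hk hk').of_keeps fun x hx => hx.2⟩
  | star A ih =>
    rcases h with ⟨m, s, rfl, rfl, h⟩ | ⟨s, rfl, hd, h⟩
    · exact Trace.star_sequence fun k hk => ih (h k hk).2
    · exact Trace.star_isLUB (fun m => Trace.star_sequence fun k _ => ih (h k).2) hd

/-! ### From segments to occurrences and partial executions, and back -/

theorem exists_sequence_of_reflTransGen {α : Type*} {R : α → α → Prop} {a b : α}
    (h : Relation.ReflTransGen R a b) :
    ∃ (m : ℕ) (u : ℕ → α), u 0 = a ∧ u m = b ∧ ∀ k < m, R (u k) (u (k + 1)) := by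
  induction h with
  | refl => exact ⟨0, fun _ => a, rfl, rfl, by simp⟩
  | tail _ h ih =>
    rename_i b' b _
    obtain ⟨m, u, h0, hm, hu⟩ := ih
    refine ⟨m + 1, fun k => if k ≤ m then u k else b, by simpa using h0, by simp, ?_⟩
    intro k hk
    rcases Nat.lt_succ_iff_lt_or_eq.1 hk with hk | rfl
    · simpa [hk.le, Nat.succ_le_of_lt hk] using hu k hk
    · simpa [hm] using h

theorem Seg.occurs {n : ℕ} {C : Cmd} {r : Run n} {p : Fin n} {a b : ℕ}
    (h : C.Seg (r.st p) a b) (c : Cut n) :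
    Occurs r (C.toProg p) (Function.update c p a) (Function.update c p b) := by
  have mono : ∀ {a b : ℕ}, a ≤ b → Function.update c p (a : ℕ∞) ≤ Function.update c p (b : ℕ∞) :=
    fun h => update_le_update_iff.2 ⟨by exact_mod_cast h, fun _ _ => le_rfl⟩
  induction C generalizing a b with
  | assign x e =>
    obtain ⟨rfl, h⟩ := h
    refine ⟨by simp, fun k hk => ?_⟩
    simp only [Function.update_self] at hk
    obtain rfl : a = k := by exact_mod_cast hk
    exact h
  | seq A B ihA ihB =>
    obtain ⟨m, h1, h2⟩ := h
    exact ⟨_, mono h1.le, mono h2.le, ihA h1, ihB h2⟩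
  | choice A B ihA ihB => exact h.imp ihA ihB
  | star A ih =>
    obtain ⟨m, u, rfl, rfl, hu⟩ := exists_sequence_of_reflTransGen h
    exact Or.inl ⟨m, fun k => Function.update c p (u k : ℕ∞), rfl, rfl,
      fun k hk => ⟨mono (hu k hk).le, ih (hu k hk)⟩⟩

theorem finCut_update {n : ℕ} (c : Fin n → ℕ) (p : Fin n) (a : ℕ) :
    finCut (Function.update c p a) = Function.update (finCut c) p (a : ℕ∞) := by
  ext1 i
  by_cases hi : i = p
  · subst hi
    simp [finCut]
  · simp [finCut, hi]

theorem Seg.toPartial {n : ℕ} {C : Cmd} {r : Run n} {p : Fin n} {a b : ℕ}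
    (h : C.Seg (r.st p) a b) (c : Fin n → ℕ) {H : Set (Fin n)} (hp : p ∉ H) :
    Partial r (C.toProg p) (Function.update c p a) H (Function.update c p b) H := by
  induction C generalizing a b with
  | assign x e =>
    have := h.occurs (finCut c)
    rw [← finCut_update, ← finCut_update] at this
    exact ⟨subset_rfl, Or.inr ⟨hp, this⟩⟩
  | seq A B ihA ihB =>
    obtain ⟨m, h1, h2⟩ := h
    exact ⟨_, H, ihA h1, ihB h2⟩
  | choice A B ihA ihB => exact h.imp ihA ihB
  | star A ih =>
    obtain ⟨m, u, rfl, rfl, hu⟩ := exists_sequence_of_reflTransGen h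
    exact ⟨m, fun k => Function.update c p (u k), fun _ => H, rfl, rfl, rfl, rfl,
      fun k hk => ih (hu k hk)⟩

theorem executable_toProg {n : ℕ} (p : Fin n) (C : Cmd) : (C.toProg p).Executable := by
  induction C <;> simp_all [toProg, Prog.Executable]

/-- What a partial execution of a command of process `p` says about the states of `p`. -/
structure PartialTrace {n : ℕ} (C : Cmd) (r : Run n) (p : Fin n) (c : Fin n → ℕ) (H : Set (Fin n))
    (d : Fin n → ℕ) (H' : Set (Fin n)) : Prop where
  subset : H ⊆ H'
  other : ∀ i, i ≠ p → d i = c i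
  le : c p ≤ d p
  stopped : p ∈ H → d p = c p
  seg : p ∉ H' → C.Seg (r.st p) (c p) (d p)
  ext : p ∉ H → p ∈ H' → ∃ (g : ℕ → LocalState n) (b : ℕ), d p ≤ b ∧
    (∀ k ≤ d p, g k = r.st p k) ∧ C.Seg g (c p) b

/-- The field `ext` serves deadlock-freedom: if `p` has stopped on the way, its states after `d p`
can be replaced so that the command is completed, because commands do not block. -/
theorem partialTrace_of_partial {n : ℕ} {C : Cmd} {r : Run n} {p : Fin n} {c d : Fin n → ℕ}
    {H H' : Set (Fin n)} (h : Partial r (C.toProg p) c H d H') : C.PartialTrace r p c H d H' := by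
  induction C generalizing c d H H' with
  | assign x e =>
    obtain ⟨hH, ⟨hp, rfl⟩ | ⟨hp, h1, h2⟩⟩ := h
    · refine ⟨hH, fun _ _ => rfl, le_rfl, fun _ => rfl, fun h => absurd hp h, fun _ _ => ?_⟩
      obtain ⟨g, b, h1, h2⟩ := (assign x e).exists_seg (r.st p) (c p)
      exact ⟨g, b, h2.le, h1, h2⟩
    · have hd : d = Function.update c p (c p + 1) := by
        ext i
        have := congrFun h1 i
        by_cases hi : i = p
        · subst hi
          simp only [finCut, Function.update_self] at this ⊢
          exact_mod_cast this
        · simpa [finCut, hi] using this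
      subst hd
      refine ⟨hH, fun i hi => Function.update_of_ne hi _ _, by simp, fun h => absurd (hH h) hp,
        fun _ => ⟨by simp, h2 (c p) rfl⟩, fun _ h => absurd h hp⟩
  | seq A B ihA ihB =>
    obtain ⟨c', H₁, h1, h2⟩ := h
    replace h1 := ihA h1
    replace h2 := ihB h2
    refine ⟨h1.subset.trans h2.subset, fun i hi => (h2.other i hi).trans (h1.other i hi),
      h1.le.trans h2.le, fun h => (h2.stopped (h1.subset h)).trans (h1.stopped h),
      fun h => ⟨_, h1.seg fun h' => h (h2.subset h'), h2.seg h⟩, fun h h' => ?_⟩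
    by_cases hp : p ∈ H₁
    -- Here `p` stopped before or during `A`, so `B` contributes no events: complete `A`, then
    -- append some execution of `B`.
    · obtain ⟨g, m, hm, hg, hgA⟩ := h1.ext h hp
      obtain ⟨g', b, hg', hgB⟩ := B.exists_seg g m
      rw [h2.stopped hp]
      exact ⟨g', b, hm.trans hgB.le, fun k hk => (hg' k (hk.trans hm)).trans (hg k hk),
        m, hgA.congr hg', hgB⟩
    · obtain ⟨g, b, hb, hg, hgB⟩ := h2.ext hp h'
      have hA := h1.seg hp
      exact ⟨g, b, hb, hg, _, hA.congr fun k hk => hg k (hk.trans h2.le), hgB⟩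
  | choice A B ihA ihB =>
    rcases h with h | h
    · have h := ihA h
      refine ⟨h.subset, h.other, h.le, h.stopped, fun hp => Or.inl (h.seg hp), fun h1 h2 => ?_⟩
      obtain ⟨g, b, h3, h4, h5⟩ := h.ext h1 h2
      exact ⟨g, b, h3, h4, Or.inl h5⟩
    · have h := ihB h
      refine ⟨h.subset, h.other, h.le, h.stopped, fun hp => Or.inr (h.seg hp), fun h1 h2 => ?_⟩
      obtain ⟨g, b, h3, h4, h5⟩ := h.ext h1 h2
      exact ⟨g, b, h3, h4, Or.inr h5⟩
  | star A ih =>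
    obtain ⟨m, s, u, rfl, rfl, rfl, rfl, h⟩ := h
    induction m with
    | zero =>
      exact ⟨subset_rfl, fun _ _ => rfl, le_rfl, fun _ => rfl, fun _ => .refl,
        fun h1 h2 => absurd h2 h1⟩
    | succ m ih' =>
      have h1 := ih' fun k hk => h k (by omega)
      have h2 := ih (h m (Nat.lt_succ_self m))
      refine ⟨h1.subset.trans h2.subset, fun i hi => (h2.other i hi).trans (h1.other i hi),
        h1.le.trans h2.le, fun h => (h2.stopped (h1.subset h)).trans (h1.stopped h),
        fun h => .tail (h1.seg fun h' => h (h2.subset h')) (h2.seg h), fun h h' => ?_⟩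
      -- If `p` stopped before the last round, a completion of the earlier rounds is enough, since
      -- the star may end there.
      by_cases hp : p ∈ u m
      · rw [h2.stopped hp]
        exact h1.ext h hp
      · obtain ⟨g, b, hb, hg, hgB⟩ := h2.ext hp h'
        have hA := h1.seg hp
        exact ⟨g, b, hb, hg, .tail (hA.congr fun k hk => hg k (hk.trans h2.le)) hgB⟩

end Cmd

/-! ### Commands with tests -/

/-- The expression with all variables shifted by two. -/
def Expr.shift : Expr → Expr
  | .const z => .const z
  | .var x => .var (x + 2)
  | .add a b => .add a.shift b.shift
  | .sub a b => .sub a.shift b.shift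
  | .mul a b => .mul a.shift b.shift

/-- The valuation seen by shifted expressions. -/
def regs (σ : ℕ → ℤ) : ℕ → ℤ := fun x => σ (x + 2)

theorem Expr.eval_shift (σ : ℕ → ℤ) (e : Expr) : e.shift.eval σ = e.eval (regs σ) := by
  induction e <;> simp_all [Expr.shift, Expr.eval, regs]

theorem regs_update (σ : ℕ → ℤ) (x : ℕ) (z : ℤ) :
    regs (Function.update σ (x + 2) z) = Function.update (regs σ) x z := by
  ext y
  by_cases h : y = x <;> simp [regs, h]

/-- Nondeterministic commands with tests `e = 0`. -/
inductive TestCmd : Type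
  | assign (x : ℕ) (e : Expr)
  | test (e : Expr)
  | seq (A B : TestCmd)
  | choice (A B : TestCmd)
  | star (A : TestCmd)

namespace TestCmd

/-- The executions in which all tests succeed. -/
def Sem : TestCmd → (ℕ → ℤ) → (ℕ → ℤ) → Prop
  | .assign x e => fun σ τ => τ = Function.update σ x (e.eval σ)
  | .test e => fun σ τ => τ = σ ∧ e.eval σ = 0
  | .seq A B => Relation.Comp A.Sem B.Sem
  | .choice A B => fun σ τ => A.Sem σ τ ∨ B.Sem σ τ
  | .star A => Relation.ReflTransGen A.Sem

/-- Failed tests are recorded in the variable `1`, instead of blocking the execution. The variable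
`0` is left untouched. -/
def toCmd : TestCmd → Cmd
  | .assign x e => .assign (x + 2) e.shift
  | .test e => .assign 1 (.add (.var 1) (.mul e.shift e.shift))
  | .seq A B => .seq A.toCmd B.toCmd
  | .choice A B => .choice A.toCmd B.toCmd
  | .star A => .star A.toCmd

theorem keeps_toCmd (C : TestCmd) : C.toCmd.Keeps 0 := by
  induction C <;> simp_all [toCmd, Cmd.Keeps]

/-- Each test adds a square to variable 1. Hence this variable never decreases, and it keeps its
value only if every tested expression is zero. -/
theorem le_and_sem_of_rel {C : TestCmd} {σ τ : ℕ → ℤ} (h : C.toCmd.Rel σ τ) :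
    σ 1 ≤ τ 1 ∧ (τ 1 ≤ σ 1 → C.Sem (regs σ) (regs τ)) := by
  induction C generalizing σ τ with
  | assign x e =>
    obtain rfl : τ = _ := h
    simp [Sem, regs_update, Expr.eval_shift]
  | test e =>
    obtain rfl : τ = _ := h
    have hr : regs (Function.update σ 1 (Expr.eval σ (.add (.var 1) (.mul e.shift e.shift)))) =
        regs σ := by
      ext y
      simp [regs]
    have := mul_self_nonneg (e.eval (regs σ))
    rw [hr]
    simp only [Sem, Function.update_self, Expr.eval, Expr.eval_shift]
    exact ⟨by linarith, fun h => ⟨trivial, mul_self_eq_zero.1 (by linarith)⟩⟩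
  | seq A B ihA ihB =>
    obtain ⟨ρ, h1, h2⟩ := h
    have h1 := ihA h1
    have h2 := ihB h2
    exact ⟨h1.1.trans h2.1, fun h => ⟨_, h1.2 (h2.1.trans h), h2.2 (h.trans h1.1)⟩⟩
  | choice A B ihA ihB =>
    rcases h with h | h
    · exact ⟨(ihA h).1, fun h' => Or.inl ((ihA h).2 h')⟩
    · exact ⟨(ihB h).1, fun h' => Or.inr ((ihB h).2 h')⟩
  | star A ih =>
    change Relation.ReflTransGen _ _ _ at h
    induction h with
    | refl => exact ⟨le_rfl, fun _ => .refl⟩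
    | tail _ h ih' =>
      have h := ih h
      exact ⟨ih'.1.trans h.1, fun h' => .tail (ih'.2 (h.1.trans h')) (h.2 (h'.trans ih'.1))⟩

theorem Sem.exists_rel {C : TestCmd} {ρ ρ' : ℕ → ℤ} (h : C.Sem ρ ρ') (σ : ℕ → ℤ)
    (hσ : regs σ = ρ) : ∃ τ, C.toCmd.Rel σ τ ∧ τ 1 = σ 1 ∧ regs τ = ρ' := by
  induction C generalizing ρ ρ' σ with
  | assign x e =>
    obtain rfl : ρ' = _ := h
    exact ⟨_, rfl, by simp, by rw [regs_update, Expr.eval_shift, hσ]⟩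
  | test e =>
    obtain ⟨rfl, h⟩ := h
    refine ⟨_, rfl, ?_, ?_⟩
    · simp [Expr.eval, Expr.eval_shift, hσ, h]
    · rw [← hσ]
      ext y
      simp [regs]
  | seq A B ihA ihB =>
    obtain ⟨_, h1, h2⟩ := h
    obtain ⟨σ', h3, h4, h5⟩ := ihA h1 σ hσ
    obtain ⟨τ, h6, h7, h8⟩ := ihB h2 σ' h5
    exact ⟨τ, ⟨σ', h3, h6⟩, h7.trans h4, h8⟩
  | choice A B ihA ihB =>
    rcases h with h | h
    · obtain ⟨τ, h1, h2⟩ := ihA h σ hσ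
      exact ⟨τ, Or.inl h1, h2⟩
    · obtain ⟨τ, h1, h2⟩ := ihB h σ hσ
      exact ⟨τ, Or.inr h1, h2⟩
  | star A ih =>
    change Relation.ReflTransGen _ _ _ at h
    induction h with
    | refl => exact ⟨σ, .refl, rfl, hσ⟩
    | tail _ h ih' =>
      obtain ⟨σ', h3, h4, h5⟩ := ih'
      obtain ⟨τ, h6, h7, h8⟩ := ih h σ' h5
      exact ⟨τ, .tail h3 h6, h7.trans h4, h8⟩

/-! ### Guessing and pairing -/

/-- Assign an arbitrary natural number to `v`. -/
def guess (v : ℕ) : TestCmd :=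
  .seq (.assign v (.const 0)) (.star (.assign v (.add (.var v) (.const 1))))

theorem sem_guess {v : ℕ} {σ τ : ℕ → ℤ} :
    (guess v).Sem σ τ ↔ ∃ k : ℕ, τ = Function.update σ v k := by
  constructor
  · rintro ⟨ρ, rfl, h⟩
    change Relation.ReflTransGen _ _ _ at h
    induction h with
    | refl => exact ⟨0, rfl⟩
    | tail _ h ih =>
      obtain ⟨k, rfl⟩ := ih
      obtain rfl := h
      exact ⟨k + 1, by simp [Expr.eval]⟩
  · rintro ⟨k, rfl⟩
    refine ⟨_, rfl, ?_⟩
    change Relation.ReflTransGen _ _ _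
    induction k with
    | zero => exact .refl
    | succ k ih =>
      refine .tail ih ?_
      simp [Sem, Expr.eval]

/-- Assign to `v` the pair of `v₁` and `v₂`. -/
def pack (v v₁ v₂ : ℕ) : TestCmd :=
  .choice
    (.seq (guess v) (.seq (.test (.sub (.sub (.var v₂) (.var v₁)) (.add (.var v) (.const 1))))
      (.assign v (.add (.mul (.var v₂) (.var v₂)) (.var v₁)))))
    (.seq (guess v) (.seq (.test (.sub (.sub (.var v₁) (.var v₂)) (.var v)))
      (.assign v (.add (.add (.mul (.var v₁) (.var v₁)) (.var v₁)) (.var v₂)))))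

/-- `Nat.pair x y` is `y * y + x` if `x < y`, and `x * x + x + y` otherwise. Since tests only check
equations, the comparison is certified by a guessed natural number, `y - x - 1` or `x - y`; `v`
serves as scratch space for it. -/
theorem sem_pack {v v₁ v₂ : ℕ} (h₁ : v₁ ≠ v) (h₂ : v₂ ≠ v) {σ τ : ℕ → ℤ} {x y : ℕ}
    (hx : σ v₁ = x) (hy : σ v₂ = y) :
    (pack v v₁ v₂).Sem σ τ ↔ τ = Function.update σ v (Nat.pair x y : ℕ) := by
  constructor
  · rintro (⟨ρ, h, _, ⟨rfl, h'⟩, rfl⟩ | ⟨ρ, h, _, ⟨rfl, h'⟩, rfl⟩) <;>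
      obtain ⟨k, rfl⟩ := sem_guess.1 h <;>
      simp only [Expr.eval, Function.update_of_ne h₁, Function.update_of_ne h₂, hx, hy,
        Function.update_self, Function.update_idem] at h' ⊢
    · have : x < y := by omega
      simp [Nat.pair, this]
    · have : ¬ x < y := by omega
      simp [Nat.pair, this]
  · rintro rfl
    by_cases hxy : x < y
    · refine Or.inl ⟨_, sem_guess.2 ⟨y - x - 1, rfl⟩, _, ⟨rfl, ?_⟩, ?_⟩
      · simp only [Expr.eval, Function.update_of_ne h₁, Function.update_of_ne h₂, hx, hy,
          Function.update_self]
        omega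
      · simp [Sem, Expr.eval, h₁, h₂, hx, hy, Nat.pair, hxy]
    · refine Or.inr ⟨_, sem_guess.2 ⟨x - y, rfl⟩, _, ⟨rfl, ?_⟩, ?_⟩
      · simp only [Expr.eval, Function.update_of_ne h₁, Function.update_of_ne h₂, hx, hy,
          Function.update_self]
        omega
      · simp [Sem, Expr.eval, h₁, h₂, hx, hy, Nat.pair, hxy]

/-- Decompose the pair in `b` and assign its components to `b + 1` and `b + 2`. -/
def unpack (b : ℕ) : TestCmd :=
  .seq (guess (b + 1)) (.seq (guess (b + 2)) (.seq (pack (b + 3) (b + 1) (b + 2))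
    (.test (.sub (.var (b + 3)) (.var b)))))

/-- Guess and check: pairing is injective, so only the true components pass the test. The recomputed
pair stays behind in `b + 3`. -/
theorem sem_unpack {b : ℕ} {σ τ : ℕ → ℤ} {x : ℕ} (hx : σ b = x) :
    (unpack b).Sem σ τ ↔ τ = Function.update (Function.update (Function.update σ
      (b + 1) (x.unpair.1 : ℕ)) (b + 2) (x.unpair.2 : ℕ)) (b + 3) x := by
  constructor
  · rintro ⟨_, h1, _, h2, ρ, h3, rfl, h4⟩
    obtain ⟨k, rfl⟩ := sem_guess.1 h1
    obtain ⟨l, rfl⟩ := sem_guess.1 h2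
    rw [sem_pack (x := k) (y := l) (by omega) (by omega) (by simp) (by simp)] at h3
    subst h3
    have : Nat.pair k l = x := by
      simp [Expr.eval, hx] at h4
      omega
    rw [← this, Nat.unpair_pair]
  · rintro rfl
    refine ⟨_, sem_guess.2 ⟨x.unpair.1, rfl⟩, _, sem_guess.2 ⟨x.unpair.2, rfl⟩, _,
      (sem_pack (x := x.unpair.1) (y := x.unpair.2) (by omega) (by omega) (by simp)
        (by simp)).2 rfl, ?_, ?_⟩
    · rw [Nat.pair_unpair]
    · simp [Expr.eval, hx]

/-! ### Partial recursive functions -/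

/-- The command does not change the variables below `b`. -/
def Above (b : ℕ) (C : TestCmd) : Prop := ∀ σ τ, C.Sem σ τ → ∀ i < b, τ i = σ i

theorem Above.mono {b b' : ℕ} {C : TestCmd} (h : C.Above b') (hb : b ≤ b') : C.Above b :=
  fun σ τ hC i hi => h σ τ hC i (hi.trans_le hb)

theorem above_assign {b x : ℕ} (e : Expr) (h : b ≤ x) : (assign x e).Above b := by
  rintro σ τ rfl i hi
  exact Function.update_of_ne (by omega) _ _

theorem above_test {b : ℕ} (e : Expr) : (test e).Above b := by
  rintro σ τ ⟨rfl, -⟩ i hi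
  rfl

theorem Above.seq {b : ℕ} {A B : TestCmd} (hA : A.Above b) (hB : B.Above b) :
    (seq A B).Above b := by
  rintro σ τ ⟨ρ, h1, h2⟩ i hi
  exact (hB _ _ h2 i hi).trans (hA _ _ h1 i hi)

theorem Above.choice {b : ℕ} {A B : TestCmd} (hA : A.Above b) (hB : B.Above b) :
    (choice A B).Above b := by
  rintro σ τ (h | h) i hi
  exacts [hA _ _ h i hi, hB _ _ h i hi]

theorem Above.star {b : ℕ} {A : TestCmd} (hA : A.Above b) : (star A).Above b := by
  intro σ τ h i hi
  change Relation.ReflTransGen _ _ _ at h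
  induction h with
  | refl => rfl
  | tail _ h ih => exact (hA _ _ h i hi).trans ih

theorem above_guess {b v : ℕ} (h : b ≤ v) : (guess v).Above b :=
  (above_assign _ h).seq (above_assign _ h).star

theorem above_pack {b v : ℕ} (v₁ v₂ : ℕ) (h : b ≤ v) : (pack v v₁ v₂).Above b :=
  ((above_guess h).seq ((above_test _).seq (above_assign _ h))).choice
    ((above_guess h).seq ((above_test _).seq (above_assign _ h)))

theorem above_unpack (b : ℕ) : (unpack b).Above b :=
  (above_guess (by omega)).seq ((above_guess (by omega)).seq
    ((above_pack _ _ (by omega)).seq (above_test _)))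

/-- The command replaces the value of the variable `b` by its image under `g`, and does not change
the variables below `b`. -/
structure Computes (C : TestCmd) (b : ℕ) (g : ℕ →. ℕ) : Prop where
  above : C.Above b
  sound : ∀ (σ τ : ℕ → ℤ) (x : ℕ), C.Sem σ τ → σ b = x → ∃ y ∈ g x, τ b = (y : ℕ)
  complete : ∀ (σ : ℕ → ℤ) (x y : ℕ), σ b = x → y ∈ g x → ∃ τ, C.Sem σ τ ∧ τ b = y

/-! ### Initial functions and closure under the operations of `Nat.Partrec` -/

theorem exists_computes_zero (b : ℕ) : ∃ C, Computes C b (pure 0) := by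
  refine ⟨assign b (.const 0), above_assign _ le_rfl, ?_, ?_⟩
  · rintro σ _ x rfl _
    exact ⟨0, Part.mem_some _, by simp [Expr.eval]⟩
  · rintro σ x y hx hy
    obtain rfl : y = 0 := Part.mem_some_iff.1 hy
    exact ⟨_, rfl, by simp [Expr.eval]⟩

theorem exists_computes_succ (b : ℕ) : ∃ C, Computes C b Nat.succ := by
  refine ⟨assign b (.add (.var b) (.const 1)), above_assign _ le_rfl, ?_, ?_⟩
  · rintro σ _ x rfl hx
    exact ⟨x + 1, Part.mem_some _, by simp [Expr.eval, hx]⟩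
  · rintro σ x y hx hy
    obtain rfl : y = x + 1 := Part.mem_some_iff.1 hy
    exact ⟨_, rfl, by simp [Expr.eval, hx]⟩

theorem exists_computes_left (b : ℕ) : ∃ C, Computes C b ↑fun x : ℕ => x.unpair.1 := by
  refine ⟨seq (unpack b) (assign b (.var (b + 1))),
    (above_unpack b).seq (above_assign _ le_rfl), ?_, ?_⟩
  · rintro σ _ x ⟨_, h, rfl⟩ hx
    obtain rfl := (sem_unpack hx).1 h
    exact ⟨_, Part.mem_some _, by simp [Expr.eval]⟩
  · rintro σ x y hx hy
    obtain rfl := Part.mem_some_iff.1 hy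
    exact ⟨_, ⟨_, (sem_unpack hx).2 rfl, rfl⟩, by simp [Expr.eval]⟩

theorem exists_computes_right (b : ℕ) : ∃ C, Computes C b ↑fun x : ℕ => x.unpair.2 := by
  refine ⟨seq (unpack b) (assign b (.var (b + 2))),
    (above_unpack b).seq (above_assign _ le_rfl), ?_, ?_⟩
  · rintro σ _ x ⟨_, h, rfl⟩ hx
    obtain rfl := (sem_unpack hx).1 h
    exact ⟨_, Part.mem_some _, by simp [Expr.eval]⟩
  · rintro σ x y hx hy
    obtain rfl := Part.mem_some_iff.1 hy
    exact ⟨_, ⟨_, (sem_unpack hx).2 rfl, rfl⟩, by simp [Expr.eval]⟩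

theorem exists_computes_comp {f g : ℕ →. ℕ} {b : ℕ} (hf : ∃ C, Computes C b f)
    (hg : ∃ C, Computes C b g) : ∃ C, Computes C b fun x => g x >>= f := by
  obtain ⟨F, hF⟩ := hf
  obtain ⟨G, hG⟩ := hg
  refine ⟨seq G F, hG.above.seq hF.above, ?_, ?_⟩
  · rintro σ τ x ⟨ρ, h1, h2⟩ hx
    obtain ⟨y, hy, hy'⟩ := hG.sound _ _ _ h1 hx
    obtain ⟨z, hz, hz'⟩ := hF.sound _ _ _ h2 hy'
    exact ⟨z, Part.mem_bind_iff.2 ⟨y, hy, hz⟩, hz'⟩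
  · rintro σ x z hx hz
    obtain ⟨y, hy, hz⟩ := Part.mem_bind_iff.1 hz
    obtain ⟨ρ, h1, h2⟩ := hG.complete σ x y hx hy
    obtain ⟨τ, h3, h4⟩ := hF.complete ρ y z h2 hz
    exact ⟨τ, ⟨ρ, h1, h3⟩, h4⟩

theorem mem_pair_iff {f g : ℕ →. ℕ} {x z : ℕ} :
    z ∈ Nat.pair <$> f x <*> g x ↔ ∃ y₁ ∈ f x, ∃ y₂ ∈ g x, Nat.pair y₁ y₂ = z := by
  simp [Seq.seq]

/-- `F` works on a copy of the input from `b + 1` upwards and `G` from `b + 2` upwards. So `F` does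
not destroy the input in `b`, and `G` does not destroy the value of `f` in `b + 1`. -/
theorem exists_computes_pair {f g : ℕ →. ℕ} {b : ℕ} (hf : ∃ C, Computes C (b + 1) f)
    (hg : ∃ C, Computes C (b + 2) g) :
    ∃ C, Computes C b fun x => Nat.pair <$> f x <*> g x := by
  obtain ⟨F, hF⟩ := hf
  obtain ⟨G, hG⟩ := hg
  refine ⟨seq (assign (b + 1) (.var b)) (seq F (seq (assign (b + 2) (.var b)) (seq G
    (pack b (b + 1) (b + 2))))), (above_assign _ (by omega)).seq ((hF.above.mono (by omega)).seq
    ((above_assign _ (by omega)).seq ((hG.above.mono (by omega)).seq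
    (above_pack _ _ le_rfl)))), ?_, ?_⟩
  · rintro σ τ x ⟨_, rfl, ρ₁, h1, _, rfl, ρ₂, h2, h3⟩ hx
    obtain ⟨y₁, hy₁, hy₁'⟩ := hF.sound _ _ x h1 (by simp [Expr.eval, hx])
    have hb := hF.above _ _ h1 b (by omega)
    obtain ⟨y₂, hy₂, hy₂'⟩ := hG.sound _ _ x h2 (by simp [Expr.eval, hb, hx])
    have hb1 := hG.above _ _ h2 (b + 1) (by omega)
    rw [sem_pack (x := y₁) (y := y₂) (by omega) (by omega) (by simpa [hb1] using hy₁') hy₂'] at h3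
    exact ⟨_, mem_pair_iff.2 ⟨y₁, hy₁, y₂, hy₂, rfl⟩, by simp [h3]⟩
  · rintro σ x z hx hz
    obtain ⟨y₁, hy₁, y₂, hy₂, rfl⟩ := mem_pair_iff.1 hz
    obtain ⟨ρ₁, h1, hy₁'⟩ := hF.complete (Function.update σ (b + 1) (Expr.eval σ (.var b))) x y₁
      (by simp [Expr.eval, hx]) hy₁
    have hb := hF.above _ _ h1 b (by omega)
    obtain ⟨ρ₂, h2, hy₂'⟩ := hG.complete (Function.update ρ₁ (b + 2) (Expr.eval ρ₁ (.var b))) x y₂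
      (by simp [Expr.eval, hb, hx]) hy₂
    have hb1 := hG.above _ _ h2 (b + 1) (by omega)
    exact ⟨_, ⟨_, rfl, ρ₁, h1, _, rfl, ρ₂, h2, (sem_pack (x := y₁) (y := y₂) (by omega)
      (by omega) (by simpa [hb1] using hy₁') hy₂').2 rfl⟩, by simp⟩

/-- The body of the loop for primitive recursion: the argument is in `b + 1`, the counter in `b + 3`
and the current value in `b + 4`. -/
def precBody (b : ℕ) (G : TestCmd) : TestCmd :=
  seq (pack (b + 5) (b + 3) (b + 4)) (seq (pack (b + 4) (b + 1) (b + 5)) (seq G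
    (assign (b + 3) (.add (.var (b + 3)) (.const 1)))))

theorem above_precBody {b : ℕ} {g : ℕ →. ℕ} {G : TestCmd} (hG : Computes G (b + 4) g) :
    (precBody b G).Above (b + 3) :=
  (above_pack _ _ (by omega)).seq ((above_pack _ _ (by omega)).seq
    ((hG.above.mono (by omega)).seq (above_assign _ (by omega))))

theorem precBody_sound {b : ℕ} {g : ℕ →. ℕ} {G : TestCmd} (hG : Computes G (b + 4) g)
    {σ τ : ℕ → ℤ} {a y i : ℕ} (ha : σ (b + 1) = a) (hy : σ (b + 3) = y) (hi : σ (b + 4) = i)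
    (h : (precBody b G).Sem σ τ) :
    τ (b + 3) = (y + 1 : ℕ) ∧ ∃ z ∈ g (Nat.pair a (Nat.pair y i)), τ (b + 4) = (z : ℕ) := by
  obtain ⟨_, h1, _, h2, ρ, h3, rfl⟩ := h
  obtain rfl := (sem_pack (by omega) (by omega) hy hi).1 h1
  obtain rfl := (sem_pack (x := a) (y := Nat.pair y i) (by omega) (by omega) (by simp [ha])
    (by simp)).1 h2
  obtain ⟨z, hz, hz'⟩ := hG.sound _ _ (Nat.pair a (Nat.pair y i)) h3 (by simp)
  have := hG.above _ _ h3 (b + 3) (by omega)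
  exact ⟨by simp [Expr.eval, this, hy], z, hz, by simp [hz']⟩

theorem precBody_complete {b : ℕ} {g : ℕ →. ℕ} {G : TestCmd} (hG : Computes G (b + 4) g)
    {σ : ℕ → ℤ} {a y i z : ℕ} (ha : σ (b + 1) = a) (hy : σ (b + 3) = y) (hi : σ (b + 4) = i)
    (hz : z ∈ g (Nat.pair a (Nat.pair y i))) :
    ∃ τ, (precBody b G).Sem σ τ ∧ τ (b + 3) = (y + 1 : ℕ) ∧ τ (b + 4) = z := by
  obtain ⟨ρ, h3, hzρ⟩ := hG.complete (Function.update (Function.update σ (b + 5)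
    (Nat.pair y i : ℕ)) (b + 4) (Nat.pair a (Nat.pair y i) : ℕ)) (Nat.pair a (Nat.pair y i)) z
    (by simp) hz
  have := hG.above _ _ h3 (b + 3) (by omega)
  exact ⟨_, ⟨_, (sem_pack (by omega) (by omega) hy hi).2 rfl, _,
    (sem_pack (x := a) (y := Nat.pair y i) (by omega) (by omega) (by simp [ha])
    (by simp)).2 rfl, ρ, h3, rfl⟩, by simp [Expr.eval, this, hy], by simp [hzρ]⟩

/-- The partial function defined from `f` and `g` by primitive recursion. -/
def precPart (f g : ℕ →. ℕ) (a n : ℕ) : Part ℕ :=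
  n.rec (f a) fun y IH => do let i ← IH; g (Nat.pair a (Nat.pair y i))

theorem mem_precPart_succ {f g : ℕ →. ℕ} {a n z : ℕ} :
    z ∈ precPart f g a (n + 1) ↔ ∃ i ∈ precPart f g a n, z ∈ g (Nat.pair a (Nat.pair n i)) :=
  Part.mem_bind_iff

/-- The star performs an arbitrary number of rounds, and a final test compares the counter in `b +
3` with the required number in `b + 2`. `F` and `G` work from `b + 4` upwards and leave argument,
bound and counter intact. -/
theorem exists_computes_prec {f g : ℕ →. ℕ} {b : ℕ} (hf : ∃ C, Computes C (b + 4) f)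
    (hg : ∃ C, Computes C (b + 4) g) :
    ∃ C, Computes C b (Nat.unpaired (precPart f g)) := by
  obtain ⟨F, hF⟩ := hf
  obtain ⟨G, hG⟩ := hg
  have hloop : ∀ {ρ ρ' : ℕ → ℤ}, (star (precBody b G)).Sem ρ ρ' → ∀ {a i : ℕ}, ρ (b + 1) = a →
      ρ (b + 3) = (0 : ℕ) → ρ (b + 4) = i → i ∈ f a →
      ∃ y j : ℕ, ρ' (b + 3) = y ∧ ρ' (b + 4) = j ∧ j ∈ precPart f g a y := by
    intro ρ ρ' h a i ha h0 hi hfi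
    change Relation.ReflTransGen _ _ _ at h
    induction h with
    | refl => exact ⟨0, i, h0, hi, hfi⟩
    | tail h1 h2 ih =>
      obtain ⟨y, j, hy, hj, hm⟩ := ih
      have ha' := (above_precBody hG).star _ _ h1 (b + 1) (by omega)
      obtain ⟨h3, z, hz, hz'⟩ := precBody_sound hG (ha'.trans ha) hy hj h2
      exact ⟨y + 1, z, h3, hz', mem_precPart_succ.2 ⟨j, hm, hz⟩⟩
  have hloop' : ∀ {ρ : ℕ → ℤ} {a i : ℕ} (y j : ℕ), ρ (b + 1) = a → ρ (b + 3) = (0 : ℕ) →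
      (∀ i ∈ f a, ρ (b + 4) = (i : ℕ)) → j ∈ precPart f g a y →
      ∃ ρ', (star (precBody b G)).Sem ρ ρ' ∧ ρ' (b + 3) = y ∧ ρ' (b + 4) = j := by
    intro ρ a i y j ha h0 hi
    induction y generalizing j with
    | zero => exact fun hj => ⟨ρ, .refl, h0, hi j hj⟩
    | succ y ih =>
      intro hj
      obtain ⟨k, hk, hj⟩ := mem_precPart_succ.1 hj
      obtain ⟨ρ', h1, h2, h3⟩ := ih k hk
      have ha' := (above_precBody hG).star _ _ h1 (b + 1) (by omega)
      obtain ⟨ρ'', h4, h5, h6⟩ := precBody_complete hG (ha'.trans ha) h2 h3 hj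
      exact ⟨ρ'', .tail h1 h4, h5, h6⟩
  -- `unpack` leaves the input in `b + 3`, which therefore has to be reset before it can serve as
  -- the counter.
  refine ⟨seq (unpack b) (seq (assign (b + 3) (.const 0)) (seq (assign (b + 4) (.var (b + 1)))
    (seq F (seq (star (precBody b G)) (seq (test (.sub (.var (b + 2)) (.var (b + 3))))
    (assign b (.var (b + 4)))))))), ?_, ?_, ?_⟩
  · exact (above_unpack b).seq ((above_assign _ (by omega)).seq ((above_assign _ (by omega)).seq
      ((hF.above.mono (by omega)).seq ((((above_precBody hG).mono (by omega)).star).seq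
      ((above_test _).seq (above_assign _ le_rfl))))))
  · rintro σ τ x ⟨_, h1, _, rfl, _, rfl, ρ, h2, ρ', h3, _, ⟨rfl, h4⟩, rfl⟩ hx
    obtain rfl := (sem_unpack hx).1 h1
    obtain ⟨i, hi, hi'⟩ := hF.sound _ _ x.unpair.1 h2 (by simp [Expr.eval])
    have k1 := hF.above _ _ h2 (b + 1) (by omega)
    have k2 := hF.above _ _ h2 (b + 2) (by omega)
    have k3 := hF.above _ _ h2 (b + 3) (by omega)
    have k4 := (above_precBody hG).star _ _ h3 (b + 2) (by omega)
    simp [Expr.eval] at k1 k2 k3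
    obtain ⟨y, j, hy, hj, hm⟩ := hloop h3 (a := x.unpair.1) k1 k3 hi' hi
    simp only [Expr.eval, k4, k2, hy] at h4
    obtain rfl : x.unpair.2 = y := by omega
    exact ⟨j, hm, by simp [Expr.eval, hj]⟩
  · rintro σ x z hx hz
    change z ∈ precPart f g x.unpair.1 x.unpair.2 at hz
    -- `F` is executed before the loop, whatever the number of rounds, so `f` must be defined at the
    -- argument; this follows by descending to the base of the recursion.
    have hdom : ∃ i, i ∈ f x.unpair.1 := by
      generalize x.unpair.2 = y at hz
      induction y generalizing z with
      | zero => exact ⟨z, hz⟩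
      | succ y ih =>
        obtain ⟨i, hi, -⟩ := mem_precPart_succ.1 hz
        exact ih i hi
    obtain ⟨i, hi⟩ := hdom
    set σ₁ := Function.update (Function.update (Function.update σ
      (b + 1) (x.unpair.1 : ℤ)) (b + 2) (x.unpair.2 : ℤ)) (b + 3) (x : ℤ) with hσ₁
    set σ₂ := Function.update σ₁ (b + 3) (Expr.eval σ₁ (.const 0)) with hσ₂
    set σ₃ := Function.update σ₂ (b + 4) (Expr.eval σ₂ (.var (b + 1))) with hσ₃
    obtain ⟨ρ, h2, hi'⟩ := hF.complete σ₃ x.unpair.1 i (by simp [σ₃, σ₂, σ₁, Expr.eval]) hi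
    have k1 := hF.above _ _ h2 (b + 1) (by omega)
    have k2 := hF.above _ _ h2 (b + 2) (by omega)
    have k3 := hF.above _ _ h2 (b + 3) (by omega)
    simp [σ₃, σ₂, σ₁, Expr.eval] at k1 k2 k3
    obtain ⟨ρ', h3, hy, hj⟩ := hloop' (i := i) x.unpair.2 z k1 k3
      (fun i' h' => Part.mem_unique hi h' ▸ hi') hz
    have k4 := (above_precBody hG).star _ _ h3 (b + 2) (by omega)
    exact ⟨_, ⟨_, (sem_unpack hx).2 rfl, _, rfl, _, rfl, ρ, h2, ρ', h3, _,
      ⟨rfl, by simp [Expr.eval, k4, k2, hy]⟩, rfl⟩, by simp [Expr.eval, hj]⟩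

/-- Evaluate the function on the pair of `b` and `b + 1`. -/
def rfindEval (b : ℕ) (F : TestCmd) : TestCmd := seq (pack (b + 2) b (b + 1)) F

/-- The body of the loop for minimization: the counter is in `b + 1`. -/
def rfindBody (b : ℕ) (F : TestCmd) : TestCmd :=
  seq (rfindEval b F) (seq (guess (b + 3)) (seq
    (test (.sub (.var (b + 2)) (.add (.var (b + 3)) (.const 1))))
    (assign (b + 1) (.add (.var (b + 1)) (.const 1)))))

theorem above_rfindEval {b : ℕ} {f : ℕ →. ℕ} {F : TestCmd} (hF : Computes F (b + 2) f) :
    (rfindEval b F).Above (b + 2) :=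
  (above_pack _ _ le_rfl).seq hF.above

theorem above_rfindBody {b : ℕ} {f : ℕ →. ℕ} {F : TestCmd} (hF : Computes F (b + 2) f) :
    (rfindBody b F).Above (b + 1) :=
  ((above_rfindEval hF).mono (by omega)).seq ((above_guess (by omega)).seq
    ((above_test _).seq (above_assign _ le_rfl)))

theorem rfindEval_sound {b : ℕ} {f : ℕ →. ℕ} {F : TestCmd} (hF : Computes F (b + 2) f)
    {σ τ : ℕ → ℤ} {a m : ℕ} (ha : σ b = a) (hm : σ (b + 1) = m) (h : (rfindEval b F).Sem σ τ) :
    ∃ z ∈ f (Nat.pair a m), τ (b + 2) = (z : ℕ) := by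
  obtain ⟨_, h1, h2⟩ := h
  obtain rfl := (sem_pack (by omega) (by omega) ha hm).1 h1
  exact hF.sound _ _ _ h2 (by simp)

theorem rfindEval_complete {b : ℕ} {f : ℕ →. ℕ} {F : TestCmd} (hF : Computes F (b + 2) f)
    {σ : ℕ → ℤ} {a m z : ℕ} (ha : σ b = a) (hm : σ (b + 1) = m) (hz : z ∈ f (Nat.pair a m)) :
    ∃ τ, (rfindEval b F).Sem σ τ ∧ τ (b + 2) = z := by
  obtain ⟨τ, h1, h2⟩ := hF.complete (Function.update σ (b + 2) (Nat.pair a m : ℕ)) _ z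
    (by simp) hz
  exact ⟨τ, ⟨_, (sem_pack (by omega) (by omega) ha hm).2 rfl, h1⟩, h2⟩

theorem rfindBody_sound {b : ℕ} {f : ℕ →. ℕ} {F : TestCmd} (hF : Computes F (b + 2) f)
    {σ τ : ℕ → ℤ} {a m : ℕ} (ha : σ b = a) (hm : σ (b + 1) = m) (h : (rfindBody b F).Sem σ τ) :
    τ (b + 1) = (m + 1 : ℕ) ∧ ∃ z, z + 1 ∈ f (Nat.pair a m) := by
  obtain ⟨ρ, h1, _, h2, _, ⟨rfl, h3⟩, rfl⟩ := h
  obtain ⟨z, hz, hz'⟩ := rfindEval_sound hF ha hm h1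
  have k := above_rfindEval hF _ _ h1 (b + 1) (by omega)
  obtain ⟨j, rfl⟩ := sem_guess.1 h2
  simp [Expr.eval, hz'] at h3
  obtain rfl : z = j + 1 := by omega
  exact ⟨by simp [Expr.eval, k, hm], j, hz⟩

theorem rfindBody_complete {b : ℕ} {f : ℕ →. ℕ} {F : TestCmd} (hF : Computes F (b + 2) f)
    {σ : ℕ → ℤ} {a m z : ℕ} (ha : σ b = a) (hm : σ (b + 1) = m)
    (hz : z + 1 ∈ f (Nat.pair a m)) : ∃ τ, (rfindBody b F).Sem σ τ ∧ τ (b + 1) = (m + 1 : ℕ) := by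
  obtain ⟨ρ, h1, hz'⟩ := rfindEval_complete hF ha hm hz
  have k := above_rfindEval hF _ _ h1 (b + 1) (by omega)
  exact ⟨_, ⟨ρ, h1, _, sem_guess.2 ⟨z, rfl⟩, _, ⟨rfl, by simp [Expr.eval, hz']⟩, rfl⟩,
    by simp [Expr.eval, k, hm]⟩

theorem mem_rfind_iff {f : ℕ →. ℕ} {a m : ℕ} :
    (m ∈ Nat.rfind fun k => (fun z => decide (z = 0)) <$> f (Nat.pair a k)) ↔
      0 ∈ f (Nat.pair a m) ∧ ∀ k < m, ∃ z, z + 1 ∈ f (Nat.pair a k) := by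
  refine Nat.mem_rfind.trans (and_congr (by simp) (forall_congr' fun k => forall_congr' fun _ => ?_))
  simp only [Part.map_eq_map, Part.mem_map_iff, decide_eq_false_iff_not]
  constructor
  · rintro ⟨z, hz, h0⟩
    obtain ⟨z, rfl⟩ := Nat.exists_eq_succ_of_ne_zero h0
    exact ⟨z, hz⟩
  · rintro ⟨z, hz⟩
    exact ⟨_, hz, by simp⟩

/-- A round succeeds only if the value at the counter is positive, certified by a guess of its
predecessor. The test after the loop requires the value zero. Together they leave the least zero as
the only place to stop. -/
theorem exists_computes_rfind {f : ℕ →. ℕ} {b : ℕ} (hf : ∃ C, Computes C (b + 2) f) :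
    ∃ C, Computes C b
      fun a => Nat.rfind fun k => (fun z => decide (z = 0)) <$> f (Nat.pair a k) := by
  obtain ⟨F, hF⟩ := hf
  have hloop : ∀ {ρ ρ' : ℕ → ℤ}, (star (rfindBody b F)).Sem ρ ρ' → ∀ {a : ℕ}, ρ b = a →
      ρ (b + 1) = (0 : ℕ) →
      ∃ m : ℕ, ρ' (b + 1) = m ∧ ∀ k < m, ∃ z, z + 1 ∈ f (Nat.pair a k) := by
    intro ρ ρ' h a ha h0
    change Relation.ReflTransGen _ _ _ at h
    induction h with
    | refl => exact ⟨0, h0, by simp⟩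
    | tail h1 h2 ih =>
      obtain ⟨m, hm, h⟩ := ih
      have ha' := (above_rfindBody hF).star _ _ h1 b (by omega)
      obtain ⟨h3, h4⟩ := rfindBody_sound hF (ha'.trans ha) hm h2
      refine ⟨m + 1, h3, fun k hk => ?_⟩
      rcases Nat.lt_succ_iff_lt_or_eq.1 hk with hk | rfl
      exacts [h k hk, h4]
  have hloop' : ∀ {ρ : ℕ → ℤ} {a : ℕ} (m : ℕ), ρ b = a → ρ (b + 1) = (0 : ℕ) →
      (∀ k < m, ∃ z, z + 1 ∈ f (Nat.pair a k)) →
      ∃ ρ', (star (rfindBody b F)).Sem ρ ρ' ∧ ρ' (b + 1) = m := by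
    intro ρ a m ha h0 h
    induction m with
    | zero => exact ⟨ρ, .refl, h0⟩
    | succ m ih =>
      obtain ⟨ρ', h1, h2⟩ := ih fun k hk => h k (by omega)
      have ha' := (above_rfindBody hF).star _ _ h1 b (by omega)
      obtain ⟨z, hz⟩ := h m (Nat.lt_succ_self m)
      obtain ⟨ρ'', h3, h4⟩ := rfindBody_complete hF (ha'.trans ha) h2 hz
      exact ⟨ρ'', .tail h1 h3, h4⟩
  refine ⟨seq (assign (b + 1) (.const 0)) (seq (star (rfindBody b F)) (seq (rfindEval b F)
    (seq (test (.var (b + 2))) (assign b (.var (b + 1)))))), ?_, ?_, ?_⟩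
  · exact (above_assign _ (by omega)).seq ((((above_rfindBody hF).mono (by omega)).star).seq
      (((above_rfindEval hF).mono (by omega)).seq ((above_test _).seq (above_assign _ le_rfl))))
  · rintro σ τ x ⟨_, rfl, ρ, h1, ρ', h2, _, ⟨rfl, h3⟩, rfl⟩ hx
    obtain ⟨m, hm, h⟩ := hloop h1 (a := x) (by simp [hx]) (by simp [Expr.eval])
    have k1 := (above_rfindBody hF).star _ _ h1 b (by omega)
    obtain ⟨z, hz, hz'⟩ := rfindEval_sound hF (a := x) (by simpa [hx] using k1) hm h2
    have k2 := above_rfindEval hF _ _ h2 (b + 1) (by omega)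
    simp only [Expr.eval, hz'] at h3
    obtain rfl : z = 0 := by exact_mod_cast h3
    exact ⟨m, mem_rfind_iff.2 ⟨hz, h⟩, by simp [Expr.eval, k2, hm]⟩
  · rintro σ x m hx hm
    obtain ⟨h0, h⟩ := mem_rfind_iff.1 hm
    obtain ⟨ρ, h1, h2⟩ := hloop' (ρ := Function.update σ (b + 1) (Expr.eval σ (.const 0))) m
      (a := x) (by simp [hx]) (by simp [Expr.eval]) h
    have k1 := (above_rfindBody hF).star _ _ h1 b (by omega)
    obtain ⟨ρ', h3, h4⟩ := rfindEval_complete hF (a := x) (by simpa [hx] using k1) h2 h0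
    have k2 := above_rfindEval hF _ _ h3 (b + 1) (by omega)
    exact ⟨_, ⟨_, rfl, ρ, h1, ρ', h3, _, ⟨rfl, by simp [Expr.eval, h4]⟩, rfl⟩,
      by simp [Expr.eval, k2, h2]⟩

/-- Every partial recursive function is computed by a command. -/
theorem exists_computes {g : ℕ →. ℕ} (hg : Nat.Partrec g) (b : ℕ) : ∃ C, Computes C b g := by
  induction hg generalizing b with
  | zero => exact exists_computes_zero b
  | succ => exact exists_computes_succ b
  | left => exact exists_computes_left b
  | right => exact exists_computes_right b
  | pair _ _ hf hg => exact exists_computes_pair (hf _) (hg _)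
  | comp _ _ hf hg => exact exists_computes_comp (hf b) (hg b)
  | prec _ _ hf hg => exact exists_computes_prec (hf _) (hg _)
  | rfind _ hf => exact exists_computes_rfind (hf _)

end TestCmd

/-! ### Programs that report the success of a command -/

/-- The command `M`, where the variable `0` is set to `0` during the execution of `M` and to `1`
at the end. -/
def marked (M : Cmd) : Cmd :=
  .seq (.assign 0 (.const 0)) (.seq M (.assign 0 (.const 1)))

/-- Send a message to oneself if the variable `1` is zero. -/
def report {n : ℕ} (p : Fin n) : Prog n :=
  .choice (.layer (.guard (.eq p (.var 1) p (.const 0))) (.send p p (.const 0)))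
    (.guard (.not (.eq p (.var 1) p (.const 0))))

/-- Execute `M` and send a message if it succeeds. -/
def reporting {n : ℕ} (p : Fin n) (M : Cmd) : Prog n :=
  .layer ((marked M).toProg p) (report p)

theorem executable_reporting {n : ℕ} (p : Fin n) (M : Cmd) : (reporting p M).Executable :=
  ⟨Cmd.executable_toProg p _, ⟨trivial, trivial⟩, trivial⟩

/-- The program `report p` is executed along the sequence `f` of local states between the indices
`a` and `b`. -/
def ReportSeg {n : ℕ} (p : Fin n) (f : ℕ → LocalState n) (a b : ℕ) : Prop :=
  ((f a).vars 1 = 0 ∧ b = a + 1 ∧ sendEffect p (.const 0) (f a) (f (a + 1))) ∨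
    ((f a).vars 1 ≠ 0 ∧ b = a)

namespace ReportSeg

variable {n : ℕ} {p : Fin n} {f g : ℕ → LocalState n} {a b : ℕ}

theorem le (h : ReportSeg p f a b) : a ≤ b := by
  rcases h with ⟨_, rfl, _⟩ | ⟨_, rfl⟩ <;> omega

theorem congr (h : ReportSeg p f a b) (hfg : ∀ k ≤ b, g k = f k) : ReportSeg p g a b := by
  rcases h with ⟨h1, rfl, h2⟩ | ⟨h1, rfl⟩
  · refine Or.inl ⟨?_, rfl, ?_⟩ <;> rw [hfg a (by omega)]
    · exact h1
    · rwa [hfg (a + 1) le_rfl]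
  · exact Or.inr ⟨by rwa [hfg b le_rfl], rfl⟩

theorem hist (h : ReportSeg p f a b) {k : ℕ} (hak : a ≤ k) (hkb : k < b) :
    (f (k + 1)).hist = (f k).hist ++ [.sent p 0] := by
  rcases h with ⟨_, rfl, h⟩ | ⟨_, rfl⟩
  · obtain rfl : a = k := by omega
    exact congrArg LocalState.hist h
  · omega

theorem occurs {r : Run n} (h : ReportSeg p (r.st p) a b) (c : Cut n) :
    Occurs r (report p) (Function.update c p a) (Function.update c p b) := by
  -- Processes at `⊤` are unspecified; `toNat` gives them the junk index `0`.
  have hσ : ∀ i, i ∉ (∅ : Set (Fin n)) → ∀ k : ℕ, Function.update c p (a : ℕ∞) i = k →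
      (fun i => (r.st i (Function.update c p (a : ℕ∞) i).toNat).vars) i = (r.st i k).vars := by
    intro i _ k hk
    simp only [hk, ENat.toNat_natCast]
  rcases h with ⟨h1, rfl, h2⟩ | ⟨h1, rfl⟩
  · refine Or.inl ⟨_, le_rfl, ?_, ⟨rfl, _, hσ, ?_⟩, ?_, ?_⟩
    · exact update_le_update_iff.2 ⟨by simp, fun _ _ => le_rfl⟩
    · simpa [Formula.eval, Expr.eval] using h1
    · simp
    · intro k hk
      simp only [Function.update_self] at hk
      obtain rfl : a = k := by exact_mod_cast hk
      exact h2
  · refine Or.inr ⟨rfl, _, hσ, ?_⟩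
    simpa [Formula.eval, Expr.eval] using h1

theorem of_occurs {r : Run n} {c d : Cut n} (h : Occurs r (report p) c d) (ha : c p = a) :
    ∃ b : ℕ, d = Function.update c p (b : ℕ∞) ∧ ReportSeg p (r.st p) a b := by
  rcases h with ⟨_, _, _, ⟨rfl, σ, hσ, h1⟩, rfl, h2⟩ | ⟨rfl, σ, hσ, h1⟩
  · refine ⟨a + 1, by simp [ha], Or.inl ⟨?_, rfl, h2 a ha⟩⟩
    simpa [Formula.eval, Expr.eval, hσ p (by simp) a ha] using h1
  · refine ⟨a, by simp [← ha], Or.inr ⟨?_, rfl⟩⟩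
    simpa [Formula.eval, Expr.eval, hσ p (by simp) a ha] using h1

theorem toPartial {r : Run n} (h1 : (r.st p a).vars 1 = 0)
    (h2 : sendEffect p (.const 0) (r.st p a) (r.st p (a + 1))) (c : Fin n → ℕ) :
    Partial r (report p) (Function.update c p a) ∅ (Function.update c p (a + 1)) ∅ := by
  refine Or.inl ⟨_, ∅, ⟨subset_rfl, rfl, Or.inr
    ⟨fun i => (r.st i (Function.update c p a i)).vars, ?_, ?_⟩⟩, subset_rfl,
    Or.inr ⟨Set.notMem_empty p, ?_, ?_⟩⟩
  · intro i _ k hk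
    have hk : Function.update c p a i = k := by simpa only [finCut, Nat.cast_inj] using hk
    simp only [hk]
  · simpa [Formula.eval, Expr.eval] using h1
  · simp [Cmd.finCut_update]
  · intro k hk
    simp only [Cmd.finCut_update, Function.update_self] at hk
    obtain rfl : a = k := by exact_mod_cast hk
    exact h2

/-- The first alternative collects all cases in which nothing was sent, and `report` can then be
executed afresh. If something was sent, `p` had not stopped, so the preceding command is complete.
-/
theorem of_partial {r : Run n} {c d : Fin n → ℕ} {H H' : Set (Fin n)}
    (h : Partial r (report p) c H d H') :
    d = c ∨ (p ∉ H ∧ ReportSeg p (r.st p) (c p) (d p) ∧ ∀ i, i ≠ p → d i = c i) := by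
  rcases h with ⟨_, H₁, ⟨hH, rfl, h1⟩, hH', ⟨_, rfl⟩ | ⟨hp, h2, h3⟩⟩ | ⟨_, rfl, _⟩
  · exact Or.inl rfl
  · have hp₁ : p ∉ H₁ := fun h => hp (hH' h)
    have hd : d = Function.update c p (c p + 1) := by
      ext i
      have := congrFun h2 i
      by_cases hi : i = p
      · subst hi
        simp only [finCut, Function.update_self] at this ⊢
        exact_mod_cast this
      · simpa [finCut, hi] using this
    subst hd
    refine Or.inr ⟨fun h => hp₁ (hH h), Or.inl ⟨?_, by simp, h3 (c p) rfl⟩,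
      fun i hi => Function.update_of_ne hi _ _⟩
    rcases h1 with rfl | ⟨σ, hσ, h1⟩
    · exact absurd trivial hp₁
    · simpa [Formula.eval, Expr.eval, hσ p hp₁ (c p) rfl] using h1
  · exact Or.inl rfl

end ReportSeg

theorem exists_reportSeg {n : ℕ} (p : Fin n) (f : ℕ → LocalState n) (a : ℕ) :
    ∃ (g : ℕ → LocalState n) (b : ℕ), (∀ k ≤ a, g k = f k) ∧ ReportSeg p g a b := by
  by_cases h : (f a).vars 1 = 0
  · refine ⟨fun k => if k ≤ a then f k else
      ⟨(f a).vars, (f a).hist ++ [.sent p ((Expr.const 0).eval (f a).vars)]⟩, a + 1,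
      fun k hk => by simp [hk], Or.inl ⟨by simpa using h, rfl, ?_⟩⟩
    simp [sendEffect]
  · exact ⟨f, a, fun _ _ => rfl, Or.inr ⟨h, rfl⟩⟩

/-- A run that has executed a part of `reporting p M` can be changed so that it continues with a
given complete execution. -/
theorem exists_run_reporting {n : ℕ} {p : Fin n} {M : Cmd} (r : Run n) {c d : Fin n → ℕ}
    (hc : r.SilentAt (finCut c)) (hd : r.ClosedAt (finCut d)) (hcd : ∀ i, i ≠ p → d i = c i)
    {g : ℕ → LocalState n} {m b : ℕ} (hg : ∀ k ≤ d p, g k = r.st p k) (hb : d p ≤ b)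
    (hcd' : c p ≤ d p) (h1 : (marked M).Seg g (c p) m) (h2 : ReportSeg p g m b) :
    ∃ r' ∈ RelRuns n, AgreeUpTo r r' d ∧
      Occurs r' (.layer .silent (reporting p M)) (finCut c) (Function.update (finCut d) p b) ∧
      r'.ClosedAt (Function.update (finCut d) p b) ∧ ∀ k ≤ b, r'.st p k = g k := by
  classical
  -- Process `p` follows `g` up to `b` and then idles; the other processes idle from `d` on.
  set st' : Fin n → ℕ → LocalState n :=
    fun i k => if i = p then g (min k b) else r.st i (min k (d i)) with hst'
  have hst : ∀ i, ∀ k ≤ d i, st' i k = r.st i k := by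
    intro i k hk
    by_cases hi : i = p
    · subst hi
      simp [hst', hk.trans hb, hg k hk]
    · simp [hst', hi, hk]
  have hstp : ∀ k ≤ b, st' p k = g k := fun k hk => by simp [hst', hk]
  have hkind : ∀ e, ¬ Event.In e (finCut d) → IsSend st' e ∨ IsInternal st' e := by
    rintro ⟨i, k⟩ he
    rw [event_in_finCut, not_lt] at he
    simp only at he
    by_cases hi : i = p
    · subst hi
      rcases lt_or_ge k b with hk | hk
      · rcases lt_or_ge k m with hkm | hkm
        · refine Or.inr ?_
          simp only [IsInternal]
          rw [hstp k hk.le, hstp (k + 1) hk]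
          exact (h1.quiet (hcd'.trans he) hkm).1
        · refine Or.inl ⟨i, 0, ?_⟩
          simp only [Appends]
          rw [hstp k hk.le, hstp (k + 1) hk]
          exact h2.hist hkm hk
      · refine Or.inr ?_
        simp [IsInternal, hst', hk, hk.trans (Nat.le_succ k)]
    · refine Or.inr ?_
      simp [IsInternal, hst', hi, he, he.trans (Nat.le_succ k)]
  have hnr : ∀ e, ¬ Event.In e (finCut d) → ¬ IsRecv st' e := fun e he h =>
    (hkind e he).elim h.not_isSend h.not_isInternal
  -- The matching `id` is a dummy, as no receipt lies outside `d`.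
  obtain ⟨r', hr', hr'st, hin, -⟩ := r.exists_extension d hd st' id hst
    (fun e he => (hkind e he).imp_right Or.inr) (fun e _ he _ h _ => absurd h (hnr e he))
    (fun e he i v h => absurd ⟨i, v, h⟩ (hnr e he))
  clear_value st'
  subst hr'st
  have hrecv : ∀ e, IsRecv r'.st e → Event.In e (finCut d) ∧ IsRecv r.st e ∧ r'.δ e = r.δ e := by
    intro e h
    have he := not_imp_not.1 (hnr e) h
    exact ⟨he, (isRecv_congr hst he).1 h, hin e he⟩
  have hle : finCut d ≤ Function.update (finCut d) p (b : ℕ∞) := by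
    rw [le_update_iff]
    exact ⟨by simpa [finCut] using hb, fun _ _ => le_rfl⟩
  have hcd'' : finCut c = Function.update (finCut d) p (c p : ℕ∞) := by
    rw [← Cmd.finCut_update]
    congr 1
    ext i
    by_cases hi : i = p
    · subst hi
      simp
    · simp [hi, hcd i hi]
  have mono : ∀ {a b : ℕ}, a ≤ b →
      Function.update (finCut d) p (a : ℕ∞) ≤ Function.update (finCut d) p (b : ℕ∞) :=
    fun h => update_le_update_iff.2 ⟨by exact_mod_cast h, fun _ _ => le_rfl⟩
  refine ⟨r', hr', ⟨hst, fun e _ he => hin e he⟩, ?_, ?_, hstp⟩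
  · have hsil : r'.SilentAt (finCut c) := by
      intro e h
      obtain ⟨-, h1, h2⟩ := hrecv e h
      rw [h2]
      exact hc e h1
    have o1 := (h1.congr fun k hk => hstp k (hk.trans h2.le)).occurs (finCut d)
    have o2 := (h2.congr hstp).occurs (finCut d)
    rw [← hcd''] at o1
    refine ⟨_, le_rfl, ?_, ⟨rfl, hsil⟩, _, ?_, mono h2.le, o1, o2⟩
    · rw [hcd'']
      exact mono (hcd'.trans hb)
    · rw [hcd'']
      exact mono h1.le
  · intro e h _
    obtain ⟨he, h1, h2⟩ := hrecv e h
    rw [h2]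
    exact lt_of_lt_of_le (hd e h1 he) (hle _)

/-! ### Deadlock-freedom and the sealable case -/

/-- The command can be completed from any point, and `report` has a branch for each outcome. -/
theorem deadlockFree_reporting {n : ℕ} (p : Fin n) (M : Cmd) :
    DeadlockFree (RelRuns n) (reporting p M) := by
  intro r _ c d H hc hP hd
  obtain ⟨c₁, H₁, h1, h2⟩ := hP
  have h1 := Cmd.partialTrace_of_partial h1
  obtain ⟨g, m, b, hg, hb, hother, hcd, hm, hrep⟩ : ∃ (g : ℕ → LocalState n) (m b : ℕ),
      (∀ k ≤ d p, g k = r.st p k) ∧ d p ≤ b ∧ (∀ i, i ≠ p → d i = c i) ∧ c p ≤ d p ∧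
      (marked M).Seg g (c p) m ∧ ReportSeg p g m b := by
    rcases ReportSeg.of_partial h2 with rfl | ⟨hp, h3, h4⟩
    · obtain ⟨g, m, hm, hg, hgm⟩ : ∃ (g : ℕ → LocalState n) (m : ℕ), d p ≤ m ∧
          (∀ k ≤ d p, g k = r.st p k) ∧ (marked M).Seg g (c p) m := by
        by_cases hp : p ∈ H₁
        · exact h1.ext (Set.notMem_empty p) hp
        · exact ⟨r.st p, d p, le_rfl, fun _ _ => rfl, h1.seg hp⟩
      obtain ⟨g', b, hg', hb⟩ := exists_reportSeg p g m
      exact ⟨g', m, b, fun k hk => (hg' k (hk.trans hm)).trans (hg k hk), hm.trans hb.le,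
        h1.other, h1.le, hgm.congr hg', hb⟩
    · exact ⟨r.st p, c₁ p, d p, fun _ _ => rfl, le_rfl,
        fun i hi => (h4 i hi).trans (h1.other i hi), h1.le.trans h3.le, h1.seg hp, h3⟩
  obtain ⟨r', hr', hagree, hocc, hclosed, -⟩ :=
    exists_run_reporting r hc hd hother hg hb hcd hm hrep
  refine ⟨r', hr', _, hagree, ?_, hocc, hclosed⟩
  rw [le_update_iff]
  exact ⟨by simpa [finCut] using hb, fun _ _ => le_rfl⟩

theorem deadlockFree_skip {n : ℕ} (Γ : Set (Run n)) : DeadlockFree Γ (.skip : Prog n) := by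
  rintro r hr c d H hc ⟨_, rfl⟩ hd
  exact ⟨r, hr, finCut c, ⟨fun _ _ _ => rfl, fun _ _ _ => rfl⟩, le_rfl,
    ⟨_, le_rfl, le_rfl, ⟨rfl, hc⟩, rfl⟩, hd⟩

theorem DeadlockFree.layer_skip {n : ℕ} {Γ : Set (Run n)} {P : Prog n} (hP : DeadlockFree Γ P) :
    DeadlockFree Γ (.layer P .skip) := by
  rintro r hr c d H hc ⟨_, H₁, h, _, rfl⟩ hd
  obtain ⟨r', hr', d', h1, h2, ⟨c', h3, h4, h5, h6⟩, h7⟩ := hP r hr c _ H₁ hc h hd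
  exact ⟨r', hr', d', h1, h2, ⟨c', h3, h4, h5, d', h4, le_rfl, h6, rfl⟩, h7⟩

/-- Internal events of one process do not affect the silence of a cut. -/
theorem Run.SilentAt.of_internal {n : ℕ} {r : Run n} {p : Fin n} {c d : Cut n}
    (hc : r.SilentAt c) (hother : ∀ i, i ≠ p → d i = c i) (hle : c p ≤ d p)
    (hinternal : ∀ k : ℕ, c p ≤ k → (k : ℕ∞) < d p → (r.st p (k + 1)).hist = (r.st p k).hist) :
    r.SilentAt d := by
  have key : ∀ e, ¬ IsInternal r.st e → (Event.In e d ↔ Event.In e c) := by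
    rintro ⟨i, k⟩ he
    by_cases hi : i = p
    · subst hi
      refine ⟨fun h => ?_, fun h => lt_of_lt_of_le h hle⟩
      by_contra hk
      exact he (hinternal k (not_lt.1 hk) h)
    · simp [Event.In, hother i hi]
  intro e he
  obtain ⟨i, v, h⟩ := id he
  rw [key e he.not_isInternal, key (r.δ e) (IsSend.not_isInternal ⟨_, _, (r.δ_spec e i v h).2⟩)]
  exact hc e he

/-- If `M` never succeeds, then the empty program seals `reporting p M`. -/
theorem sealable_reporting {n : ℕ} (p : Fin n) {M : Cmd}
    (hM : ∀ σ τ, M.Rel σ τ → τ 1 ≠ 0) : Sealable (RelRuns n) (reporting p M) := by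
  refine ⟨.skip, trivial, deadlockFree_skip _, (deadlockFree_reporting p M).layer_skip, ?_, ?_⟩
  · rintro r _ c d hcd ⟨_, _, _, ⟨rfl, hc⟩, d₁, h1, h2, ⟨c₁, h3, h4, h5, h6⟩, rfl⟩
    have ht := Cmd.trace_of_occurs h5
    have hd : c₁ = d₁ := by
      -- If `p` diverges, the send may formally occur at `∞`, but `∞ + 1 = ∞` leaves the cut
      -- unchanged. If `p` is at a finite index, a send would need a success of `M`.
      by_cases htop : c₁ p = ⊤
      · rcases h6 with ⟨_, _, _, ⟨rfl, _⟩, rfl, _⟩ | ⟨rfl, _⟩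
        · ext1 i
          by_cases hi : i = p
          · subst hi
            simp [htop]
          · simp [hi]
        · rfl
      · obtain ⟨m, hm⟩ := ENat.ne_top_iff_exists.1 htop
        obtain ⟨a, ha⟩ := ENat.ne_top_iff_exists.1 (ne_top_of_le_ne_top htop ht.le)
        obtain ⟨b, rfl, ⟨hb, -, -⟩ | ⟨-, rfl⟩⟩ := ReportSeg.of_occurs h6 hm.symm
        · obtain ⟨_, -, ρ, h7, h8⟩ := (ht.seg a m ha.symm hm.symm).rel
          refine absurd ?_ (hM _ _ h7)
          rw [h8] at hb
          simpa using hb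
        · simp [hm]
    subst hd
    refine ⟨c₁, h1, le_rfl, ⟨c₁, h3, le_rfl, h5, h6⟩, c₁, le_rfl, le_rfl, ⟨rfl, ?_⟩, rfl⟩
    exact hc.of_internal ht.other ht.le fun k hk hk' => (ht.quiet k hk hk').1
  · rintro r _ c d d' _ ⟨_, _, _, ⟨rfl, _⟩, rfl⟩ hd
    exact hd

/-! ### The unsealable case -/

theorem vars_eq_of_quiet {n : ℕ} {C : Cmd} {f : ℕ → LocalState n} {a b x : ℕ} (hx : C.Keeps x)
    (hab : a ≤ b) (h : ∀ k, a ≤ k → k < b → C.Quiet f k) : (f b).vars x = (f a).vars x := by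
  induction b, hab using Nat.le_induction with
  | base => rfl
  | succ b hb ih =>
    exact ((h b hb (Nat.lt_succ_self b)).2 x hx).trans (ih fun k hk hk' => h k hk (by omega))

/-- The marking determines where a successful execution ends. -/
theorem eq_of_occurs_reporting {n : ℕ} {r : Run n} {p : Fin n} {M : Cmd} (hM : M.Keeps 0)
    {a m : ℕ} (hseg : (marked M).Seg (r.st p) a m) (hm : (r.st p m).vars 1 = 0) {c d : Cut n}
    (hc : c p = a) (h : Occurs r (reporting p M) c d) :
    d = Function.update c p ((m + 1 : ℕ) : ℕ∞) := by
  obtain ⟨_, ⟨rfl, e0⟩, m', hM', rfl, e1⟩ := hseg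
  have z0 : (r.st p (a + 1)).vars 0 = 0 := by rw [e0]; simp [Expr.eval]
  have z1 : (r.st p (m' + 1)).vars 0 = 1 := by rw [e1]; simp [Expr.eval]
  obtain ⟨c₁, -, -, ⟨_, -, -, ⟨rfl, -⟩, c₂, -, -, oM, rfl, e2⟩, orep⟩ := h
  have ht := Cmd.trace_of_occurs oM
  have hle := ht.le
  have hquiet := ht.quiet
  simp only [Function.update_self, hc] at hle hquiet
  have zero : ∀ j : ℕ, a + 1 ≤ j → (j : ℕ∞) ≤ c₂ p → (r.st p j).vars 0 = 0 := by
    intro j hj hj'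
    rw [vars_eq_of_quiet hM hj fun k hk hk' => hquiet k (by exact_mod_cast hk)
      (lt_of_lt_of_le (by exact_mod_cast hk') hj'), z0]
  -- The marker is `1` at `m' + 1`, but `0` as long as the second execution is inside `M`. So that
  -- execution cannot diverge, and leaves `M` at `m'` at the latest.
  have hlt : c₂ p < ((m' + 1 : ℕ) : ℕ∞) := by
    by_contra hge
    rw [zero (m' + 1) (by have := hM'.le; omega) (not_lt.1 hge)] at z1
    exact absurd z1 (by norm_num)
  obtain ⟨m₂, hm₂⟩ := ENat.ne_top_iff_exists.1 hlt.ne_top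
  rw [← hm₂] at hlt hle
  norm_cast at hlt hle
  have z2 : (r.st p (m₂ + 1)).vars 0 = 1 := by rw [e2 m₂ hm₂.symm]; simp [Expr.eval]
  -- Had it left `M` earlier, the marker would be `1` while the given execution is still inside `M`.
  obtain rfl : m₂ = m' := by
    by_contra hne
    rw [vars_eq_of_quiet hM (a := a + 1) (by omega)
      fun k hk hk' => hM'.quiet hk (by omega), z0] at z2
    exact absurd z2 (by norm_num)
  obtain ⟨b, rfl, ⟨-, rfl, -⟩ | ⟨hb, -⟩⟩ := ReportSeg.of_occurs (a := m₂ + 1) orep (by simp [← hm₂])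
  · ext1 i
    by_cases hi : i = p
    · subst hi
      simp
    · simp [hi, ht.other i hi]
  · exact absurd hm hb

/-- The run in which nothing happens. -/
def idleRun (n : ℕ) : Run n where
  st _ _ := ⟨fun _ => 0, []⟩
  δ := id
  event_kind _ := Or.inr (Or.inr rfl)
  δ_inj := Function.injective_id.injOn
  δ_spec e i v h := by simp [Appends] at h
  causes_irrefl := by
    have : ∀ e e', Causes (n := n) (fun _ _ => ⟨fun _ => 0, []⟩) id e e' → e.2 < e'.2 := by
      intro e e' h
      induction h with
      | single h =>
        rcases h with h | ⟨⟨i, v, h⟩, -⟩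
        · exact h.2
        · simp [Appends] at h
      | tail _ h ih =>
        rcases h with h | ⟨⟨i, v, h⟩, -⟩
        · exact ih.trans h.2
        · simp [Appends] at h
    exact fun e h => lt_irrefl _ (this e e h)

theorem silentAt_zero {n : ℕ} (r : Run n) : r.SilentAt (finCut 0) := fun e _ => by
  simp [event_in_finCut]

/-- A run in which the message of a successful command has been sent. -/
theorem exists_run_success {n : ℕ} (p : Fin n) {M : Cmd}
    (hM : ∀ σ, ∃ τ, M.Rel σ τ ∧ τ 1 = 0) :
    ∃ r ∈ RelRuns n, ∃ m : ℕ, (marked M).Seg (r.st p) 0 m ∧ (r.st p m).vars 1 = 0 ∧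
      sendEffect p (.const 0) (r.st p m) (r.st p (m + 1)) ∧
      r.ClosedAt (finCut (Function.update 0 p (m + 1))) := by
  -- This is the valuation after resetting the marker in the initial state of `idleRun`.
  obtain ⟨τ, hτ, hτ1⟩ := hM (Function.update (fun _ => 0) 0 0)
  have hrel : (marked M).Rel (fun _ => 0) (Function.update τ 0 1) := ⟨_, rfl, τ, hτ, rfl⟩
  obtain ⟨g, m, hg, hgm, hgτ⟩ := hrel.exists_seg ((idleRun n).st p) 0 rfl
  obtain ⟨g', b, hg', hb⟩ := exists_reportSeg p g m
  have hcl : (idleRun n).ClosedAt (finCut 0) := fun e _ h => by simp [event_in_finCut] at h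
  obtain ⟨r, hr, -, -, hclosed, hst⟩ := exists_run_reporting (M := M) (c := 0) (d := 0)
    (idleRun n) (silentAt_zero _) hcl (fun _ _ => rfl)
    (fun k hk => (hg' k (hk.trans (Nat.zero_le m))).trans (hg k hk)) (Nat.zero_le b) le_rfl
    (hgm.congr hg') hb
  have hm1 : (g' m).vars 1 = 0 := by
    rw [hg' m le_rfl, hgτ]
    simpa using hτ1
  obtain ⟨-, rfl, hs⟩ | ⟨hne, -⟩ := hb
  · refine ⟨r, hr, m, (hgm.congr hg').congr fun k hk => hst k (by omega), ?_, ?_, ?_⟩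
    · rwa [hst m (by omega)]
    · rwa [hst m (by omega), hst (m + 1) le_rfl]
    · rwa [Cmd.finCut_update]
  · exact absurd hm1 hne

/-- A message from `p` to itself which is not received up to the closed finite cut `d` may be
received immediately after it. -/
theorem Run.exists_receive {n : ℕ} (r : Run n) {p : Fin n} {m : ℕ} {v : ℤ} (d : Fin n → ℕ)
    (hd : r.ClosedAt (finCut d)) (hmd : m < d p) (hsend : Appends r.st (p, m) (.sent p v))
    (hun : ∀ e, IsRecv r.st e → Event.In e (finCut d) → r.δ e ≠ (p, m)) :
    ∃ r' ∈ RelRuns n, (∀ i, ∀ k ≤ d i, r'.st i k = r.st i k) ∧ IsRecv r'.st (p, d p) ∧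
      r'.δ (p, d p) = (p, m) := by
  classical
  -- The event `(p, d p)` becomes the receipt, and everything after `d` is idle otherwise. Runs only
  -- constrain histories, so the received value need not be stored in a variable.
  set st' : Fin n → ℕ → LocalState n := fun i k =>
    if i = p ∧ d p < k then ⟨(r.st p (d p)).vars, (r.st p (d p)).hist ++ [.received p v]⟩
    else r.st i (min k (d i)) with hst'
  have hst : ∀ i, ∀ k ≤ d i, st' i k = r.st i k := by
    intro i k hk
    have : ¬ (i = p ∧ d p < k) := by
      rintro ⟨rfl, h⟩
      omega
    simp [hst', this, hk]
  have hnew : Appends st' (p, d p) (.received p v) := by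
    simp [Appends, hst']
  have hkind : ∀ e, ¬ Event.In e (finCut d) → e = (p, d p) ∨ IsInternal st' e := by
    rintro ⟨i, k⟩ he
    rw [event_in_finCut, not_lt] at he
    simp only at he
    by_cases hi : i = p
    · subst hi
      rcases he.eq_or_lt with rfl | hk
      · exact Or.inl rfl
      · refine Or.inr ?_
        simp [IsInternal, hst', hk, hk.trans (Nat.lt_succ_self k)]
    · refine Or.inr ?_
      simp [IsInternal, hst', hi, he, he.trans (Nat.le_succ k)]
  have hrecv : ∀ e, ¬ Event.In e (finCut d) → IsRecv st' e → e = (p, d p) := fun e he h =>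
    (hkind e he).resolve_right h.not_isInternal
  have hout : ¬ Event.In (p, d p) (finCut d) := by simp [event_in_finCut]
  have hmin : Event.In (p, m) (finCut d) := event_in_finCut.2 hmd
  obtain ⟨r', hr', hr'st, -, hδ⟩ := r.exists_extension d hd st' (fun _ => (p, m)) hst
    (fun e he => (hkind e he).elim (fun h => Or.inr (Or.inl (h ▸ ⟨p, v, hnew⟩)))
      fun h => Or.inr (Or.inr h))
    (fun e e' he he' h h' => (hrecv e he h).trans (hrecv e' he' h').symm)
    (by
      intro e he i w h
      obtain rfl := hrecv e he ⟨i, w, h⟩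
      have := List.append_cancel_left (hnew.symm.trans h)
      simp only [List.cons.injEq, Record.received.injEq, and_true] at this
      obtain ⟨rfl, rfl⟩ := this
      exact ⟨rfl, (appends_congr hst hmin _).2 hsend, hmin, hun⟩)
  clear_value st'
  subst hr'st
  exact ⟨r', hr', hst, ⟨p, v, hnew⟩, hδ _ hout⟩

/-- If `M` may succeed, then `reporting p M` cannot be sealed. -/
theorem not_sealable_reporting {n : ℕ} (hn : 1 ≤ n) (p : Fin n) {M : Cmd} (hM0 : M.Keeps 0)
    (hM : ∀ σ, ∃ τ, M.Rel σ τ ∧ τ 1 = 0) : ¬ Sealable (RelRuns n) (reporting p M) := by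
  rintro ⟨S, hS, -, hdf, hseal, hprop⟩
  obtain ⟨r, hr, m, hseg, hm, hsend, hclosed⟩ := exists_run_success p hM
  set d : Fin n → ℕ := Function.update 0 p (m + 1) with hd
  have hdp : d p = m + 1 := by simp [hd]
  -- The program is executed up to and including the send, and all processes stop before `S`.
  have hpart : Partial r (.layer (reporting p M) S) 0 ∅ d Set.univ := by
    have h1 := hseg.toPartial 0 (Set.notMem_empty p)
    have h0 : Function.update (0 : Fin n → ℕ) p 0 = 0 := Function.update_eq_self p 0
    rw [h0] at h1
    exact ⟨d, ∅, ⟨_, ∅, h1, ReportSeg.toPartial hm hsend 0⟩, partial_of_all_stopped hn r S d ∅⟩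
  have hdcut : finCut d = Function.update (finCut 0) p ((m + 1 : ℕ) : ℕ∞) :=
    Cmd.finCut_update _ _ _
  -- any run that agrees with `r` up to `d` can only be sealed at `d`
  have hend : ∀ r' : Run n, (∀ i, ∀ k ≤ d i, r'.st i k = r.st i k) → ∀ c',
      Occurs r' (reporting p M) (finCut 0) c' → c' = finCut d := by
    intro r' hst c' h
    rw [hdcut]
    refine eq_of_occurs_reporting hM0 (a := 0) (m := m)
      (hseg.congr fun k hk => hst p k (by omega)) ?_ rfl h
    rw [hst p m (by omega)]
    exact hm
  obtain ⟨r', hr', d', ⟨hst, -⟩, hle, hocc, hclosed'⟩ :=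
    hdf r hr 0 d Set.univ (silentAt_zero r) hpart hclosed
  have hpos : ∀ c : Cut n, finCut 0 ≤ c := fun c i => by simp [finCut]
  obtain ⟨c', -, -, hP, _, -, hle', ⟨rfl, hsil⟩, hS'⟩ := hseal r' hr' _ d' (hpos d') hocc
  obtain rfl := hend r' hst c' hP
  -- Finiteness leaves room for a further event of `p` after `S`.
  have hfin : d'.IsFinite := hprop r' hr' (finCut 0) (finCut d) d'
    ⟨_, le_rfl, hpos _, ⟨rfl, silentAt_zero r'⟩, hP⟩
    ⟨_, le_rfl, hle, ⟨rfl, hsil⟩, hS'⟩ fun i => ENat.natCast_ne_top _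
  obtain ⟨d'', rfl⟩ : ∃ d'' : Fin n → ℕ, finCut d'' = d' :=
    ⟨fun i => (d' i).toNat, funext fun i => ENat.natCast_toNat (hfin i)⟩
  have hdd : ∀ i, d i ≤ d'' i := fun i => by simpa [finCut] using hle i
  have hmd : m < d'' p := by
    have := hdd p
    omega
  have hsend' : Appends r'.st (p, m) (.sent p 0) := by
    simp only [Appends]
    rw [hst p m (by omega), hst p (m + 1) (by omega), hsend]
    rfl
  -- By silence a receipt of the message would lie in `d`, where only `p` has events, none of them
  -- after the send; causality excludes this.
  have hun : ∀ e, IsRecv r'.st e → r'.δ e ≠ (p, m) := by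
    rintro ⟨i, k⟩ he hδ
    have hin := (hsil _ he).2 (by rw [hδ, event_in_finCut]; simp [hdp])
    rw [event_in_finCut] at hin
    simp only at hin
    obtain rfl : i = p := by
      by_contra hi
      simp [hd, hi] at hin
    rw [hdp] at hin
    rcases (Nat.lt_succ_iff.1 hin).eq_or_lt with rfl | hk
    · exact r'.causes_irrefl _ (.single (Or.inr ⟨he, hδ⟩))
    · exact r'.causes_irrefl (i, k)
        (Relation.TransGen.tail (b := (i, m)) (.single (Or.inl ⟨rfl, hk⟩)) (Or.inr ⟨he, hδ⟩))
  obtain ⟨r'', hr'', hst'', hrecv, hδ⟩ :=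
    r'.exists_receive d'' hclosed' hmd hsend' fun e he _ => hun e he
  obtain ⟨_, -, -, ⟨rfl, -⟩, hPS⟩ := hocc
  -- The new receipt lies beyond `d''`, where executable programs cannot notice it.
  have hPS'' : Occurs r'' (.layer (reporting p M) S) (finCut 0) (finCut d'') :=
    Prog.Executable.occurs_congr (P := .layer (reporting p M) S)
      ⟨executable_reporting p M, hS⟩ (hpos _)
      (fun i k hk => hst'' i k (by simpa [finCut] using hk)) hPS
  obtain ⟨c'', -, -, hP'', _, -, -, ⟨rfl, hsil''⟩, -⟩ := hseal r'' hr'' _ _ (hpos _)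
    ⟨_, le_rfl, hpos _, ⟨rfl, silentAt_zero r''⟩, hPS''⟩
  obtain rfl := hend r'' (fun i k hk => (hst'' i k (hk.trans (hdd i))).trans (hst i k hk)) c'' hP''
  -- Silence at `d` would put the new receipt, the event `d'' p` of `p`, into `d`.
  have := (hsil'' _ hrecv).2 (by rw [hδ, event_in_finCut]; simp [hdp])
  rw [event_in_finCut] at this
  exact absurd this (not_lt.2 (hdd p))

/-! ### Undecidability -/

/-- The command `C` with input `k`, where the variable `1` records failed tests. -/
def withInput (C : TestCmd) (k : ℕ) : Cmd :=
  .seq (.assign 1 (.const 0)) (.seq (.assign 2 (.const k)) C.toCmd)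

theorem keeps_withInput (C : TestCmd) (k : ℕ) : (withInput C k).Keeps 0 :=
  ⟨by simp [Cmd.Keeps], by simp [Cmd.Keeps], C.keeps_toCmd⟩

/-- The input is stored in variable 2, which is register 0 of the shifted command. Variable 1 starts
at zero, so it ends at zero precisely when all tests succeed. -/
theorem sealable_withInput_iff {n : ℕ} (hn : 1 ≤ n) (p : Fin n) {C : TestCmd} {u : ℕ →. ℕ}
    (hC : C.Computes 0 u) (k : ℕ) :
    Sealable (RelRuns n) (reporting p (withInput C k)) ↔ ¬ (u k).Dom := by
  constructor
  · intro h hk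
    refine not_sealable_reporting hn p (keeps_withInput C k) (fun σ => ?_) h
    set σ' := Function.update (Function.update σ 1 0) 2 (k : ℤ) with hσ'
    obtain ⟨ρ, hρ, -⟩ := hC.complete (regs σ') k _ (by simp [regs, hσ']) (Part.get_mem hk)
    obtain ⟨τ, h1, h2, -⟩ := hρ.exists_rel σ' rfl
    exact ⟨τ, ⟨_, rfl, _, rfl, h1⟩, by simp [h2, hσ']⟩
  · intro h
    refine sealable_reporting p ?_
    rintro σ τ ⟨_, rfl, _, rfl, hrel⟩ hτ
    have := (TestCmd.le_and_sem_of_rel hrel).2 (by simp [hτ, Expr.eval])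
    obtain ⟨y, hy, -⟩ := hC.sound _ _ k this (by simp [regs, Expr.eval])
    exact h (Part.dom_iff_mem.2 ⟨y, hy⟩)

/-- The input enters through a single constant, and the encoding of the integer `k` is `2 * k`. The
rest of the number is built from fixed numbers by `Nat.pair`. -/
theorem computable_code_withInput {n : ℕ} (p : Fin n) (C : TestCmd) :
    Computable fun k => (reporting p (withInput C k)).code := by
  have hpair : ∀ {f g : ℕ → ℕ}, Primrec f → Primrec g → Primrec fun k => Nat.pair (f k) (g k) :=
    fun hf hg => Primrec₂.natPair.comp hf hg
  have hk : Primrec fun k : ℕ => Encodable.encode (k : ℤ) :=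
    (Primrec.nat_mul.comp (Primrec.const 2) Primrec.id).of_eq fun k => rfl
  simp only [reporting, withInput, marked, Cmd.toProg, Prog.code, Expr.code]
  refine Primrec.to_comp ?_
  repeat' first
    | with_reducible exact hk
    | with_reducible exact Primrec.const _
    | apply hpair

end Sealing

/-- For any number `n ≥ 1` of processes, no computable function decides, from the number of a
deadlock-free program, whether the program can be sealed in the class
`RelRuns n` of runs with reliable, possibly reordering, communication. -/
theorem mainTheorem6 (n : ℕ) (hn : 1 ≤ n) :
    ¬ ∃ f : ℕ → Bool, Computable f ∧
      ∀ P : Sealing.Prog n, Sealing.DeadlockFree (Sealing.RelRuns n) P →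
        (f P.code = true ↔ Sealing.Sealable (Sealing.RelRuns n) P) := by
  rintro ⟨f, hf, hP⟩
  -- A universal function: the command `C` is fixed, and the code whose halting is in question is
  -- its input.
  have hu : Nat.Partrec fun k => (Denumerable.ofNat Nat.Partrec.Code k).eval 0 :=
    Partrec.nat_iff.1 (Nat.Partrec.Code.eval_part.comp (Computable.ofNat _) (Computable.const 0))
  obtain ⟨C, hC⟩ := Sealing.TestCmd.exists_computes hu 0
  have key : ∀ k, f (Sealing.reporting ⟨0, hn⟩ (Sealing.withInput C k)).code = true ↔
      ¬ ((Denumerable.ofNat Nat.Partrec.Code k).eval 0).Dom := fun k =>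
    (hP _ (Sealing.deadlockFree_reporting _ _)).trans
      (Sealing.sealable_withInput_iff hn ⟨0, hn⟩ hC k)
  -- Sealability means divergence, so the negated answer would decide halting on input `0`.
  refine ComputablePred.halting_problem 0 (ComputablePred.computable_iff.2
    ⟨fun c => !f (Sealing.reporting ⟨0, hn⟩ (Sealing.withInput C (Encodable.encode c))).code,
      Primrec.not.to_comp.comp (hf.comp
        ((Sealing.computable_code_withInput ⟨0, hn⟩ C).comp Computable.encode)), ?_⟩)
  ext c
  have := key (Encodable.encode c)
  rw [Denumerable.ofNat_encode] at this
  simp only [Bool.not_eq_true', ← Bool.not_eq_true, this, not_not]
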